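/- Let $(A,\mathfrak m)$ be a Noetherian local ring of dimension $d\ge 2$, and let $a_1,\dots,a_d$ be a standard system of parameters of $A$, i.e. a system of parameters such that for all integers $n_1,\dots,n_d\ge 1$ the elements $a_1^{n_1},\dots,a_d^{n_d}$ form a $d$-sequence in any order (a sequence $x_1,\dots,x_d$ is a $d$-sequence if $(x_1,\dots,x_{i-1}):x_ix_j=(x_1,\dots,x_{i-1}):x_j$ for all $1\le i\le j\le d$). Put $\mathfrak q=(a_1,\dots,a_d)A$, $$\widetilde\Sigma(a_1,\dots,a_d;A)=\sum_{i=1}^d (a_1,\dots,a_{i-1},a_{i+1},\dots,a_d)A:_A a_i,\qquad \mathfrak c=(0):_A \mathrm H^1_{\mathfrak m}(A).$$ Assume that $\mathrm H^i_{\mathfrak m}(A)=0$ for all $i\ne 1,d$, that $\operatorname{depth}A=1$, and that $A$ has type $1$, i.e. $\ell_A(\mathrm{Ext}^{1}_A(A/\mathfrak m,A))=1$. Then the following are equivalent: 1. $\widetilde\Sigma(a_1,\dots,a_d;A)=\mathfrak c$; 2. $\mathrm e_{\mathfrak c}(A)=2\,\ell_A(A/\mathfrak c)$, where $\mathrm e_{\mathfrak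 c}(A)$ is the multiplicity of $A$ with respect to the $\mathfrak m$-primary ideal $\mathfrak c$, and $\mathfrak q$ is a reduction of $\mathfrak c$. When this is the case, let $x,y\in\mathfrak c$ be any filter regular sequence on $A$ (that is, $x,y\in\mathfrak m$, $0:_Ax\subseteq\bigcup_n (0:_A\mathfrak m^n)$ and $xA:_Ay\subseteq\bigcup_n (xA:_A\mathfrak m^n)$; then $x$ is a non-zero-divisor), and let $$\widetilde A=\{m/x \mid m\in xA:_A y\}\subseteq \mathrm Q(A)$$ inside the total ring of fractions $\mathrm Q(A)$ of $A$. Then $\mathfrak c=\mathfrak q\widetilde A$, and $A/(a_1,\dots,a_{d-1})\widetilde A$ is a Gorenstein local ring. -/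

import Mathlib

open CategoryTheory

/-- The depth of an `A`-module `M` over a local ring `A`: the supremum of the lengths of the `M`-regular
sequences whose entries lie in the maximal ideal. -/
noncomputable def depthLocal (A : Type*) [CommRing A] [IsLocalRing A]
    (M : Type*) [AddCommGroup M] [Module A M] : ℕ∞ :=
  ⨆ (rs : List A) (_ : ∀ r ∈ rs, r ∈ IsLocalRing.maximalIdeal A)
    (_ : RingTheory.Sequence.IsRegular M rs), (rs.length : ℕ∞)

/-- The type `r_A(M) = ℓ_A(Ext_A^t(A/𝔪, M))`, `t = depth_A M`, of a module of finite depth `t`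
over a local ring `A` (every nonzero finitely generated module over a Noetherian local ring has
finite depth). -/
noncomputable def typeLocal.{u} (A : Type u) [CommRing A] [IsLocalRing A]
    (M : Type u) [AddCommGroup M] [Module A M] : ℕ∞ :=
  Module.length A (Abelian.Ext (ModuleCat.of A (A ⧸ IsLocalRing.maximalIdeal A))
    (ModuleCat.of A M) (depthLocal A M).toNat)

/-- The ideal `𝔠 = (0) :_A H¹_𝔪(A)`. -/
noncomputable def annH1 (A : Type*) [CommRing A] [IsLocalRing A] : Ideal A :=
  Module.annihilator A
    ((localCohomology (IsLocalRing.maximalIdeal A) 1).obj (ModuleCat.of A A))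

/-- A sequence `x₀, …, x_{n-1}` is a `d`-sequence on the ring if
`(x₀, …, x_{i-1}) : x_i x_j = (x₀, …, x_{i-1}) : x_j` for all `i ≤ j`. -/
def IsDSequence {A : Type*} [CommRing A] {n : ℕ} (x : Fin n → A) : Prop :=
  ∀ i j : Fin n, i ≤ j →
    (Ideal.span (x '' {k | k < i})).colon {x i * x j} = (Ideal.span (x '' {k | k < i})).colon {x j}

/-- `a₀, …, a_{d-1}` is a system of parameters: `d = dim A`, and the `a_i` generate an
`𝔪`-primary ideal. -/
def IsSystemOfParameters {A : Type*} [CommRing A] [IsLocalRing A] {d : ℕ} (a : Fin d → A) : Prop :=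
  ringKrullDim A = d ∧ (Ideal.span (Set.range a)).radical = IsLocalRing.maximalIdeal A

/-- A system of parameters is standard if all sequences of positive powers of its members, in any
order, are `d`-sequences. -/
def IsStandardSystemOfParameters {A : Type*} [CommRing A] [IsLocalRing A] {d : ℕ}
    (a : Fin d → A) : Prop :=
  IsSystemOfParameters a ∧
    ∀ n : Fin d → ℕ, (∀ i, 1 ≤ n i) → ∀ σ : Equiv.Perm (Fin d),
      IsDSequence fun i => a (σ i) ^ n (σ i)

/-- The pair `x, y` of elements of `𝔪` is a filter regular sequence on `A`:
`0 : x ⊆ ⋃ₙ 0 : 𝔪ⁿ` and `xA : y ⊆ ⋃ₙ xA : 𝔪ⁿ`. -/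
def IsFilterRegularPair {A : Type*} [CommRing A] [IsLocalRing A] (x y : A) : Prop :=
  x ∈ IsLocalRing.maximalIdeal A ∧ y ∈ IsLocalRing.maximalIdeal A ∧
    (∀ r ∈ (⊥ : Ideal A).colon {x}, ∃ n : ℕ,
      r ∈ (⊥ : Ideal A).colon (IsLocalRing.maximalIdeal A ^ n : Ideal A)) ∧
    ∀ r ∈ (Ideal.span {x}).colon {y}, ∃ n : ℕ,
      r ∈ (Ideal.span {x}).colon (IsLocalRing.maximalIdeal A ^ n : Ideal A)

/-- `Ã = {m/x ∈ Q(A) ∣ m ∈ xA : y}` inside the total ring of fractions `Q(A)`, as an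
`A`-submodule. It is used for a non-zero-divisor `x`, and then `f = m/x` means `x f = m`. -/
noncomputable def tildeRing {A : Type*} [CommRing A] (x y : A) :
    Submodule A (FractionRing A) :=
  Submodule.comap (LinearMap.lsmul A (FractionRing A) x)
    (Submodule.map (Algebra.linearMap A (FractionRing A)) ((Ideal.span {x}).colon {y}))

/-- `Σ̃(a₀, …, a_{d-1}; A) = ∑ᵢ (a_j ∣ j ≠ i)A :_A aᵢ`. -/
def sigmaTilde {A : Type*} [CommRing A] {d : ℕ} (a : Fin d → A) : Ideal A :=
  ⨆ i, (Ideal.span (a '' {j | j ≠ i})).colon {a i}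

/-- `J` is a reduction of `I`. -/
def IsReductionOf {A : Type*} [CommRing A] (J I : Ideal A) : Prop :=
  J ≤ I ∧ ∃ n : ℕ, I ^ (n + 1) = J * I ^ n

/-- `I` is an `𝔪`-primary ideal of multiplicity `e`, that is, `d! ℓ(A/Iⁿ) / n^d` tends to `e`,
where `d = dim A`. -/
def HasMultiplicity {A : Type*} [CommRing A] [IsLocalRing A] (I : Ideal A) (e : ℕ) : Prop :=
  I.radical = IsLocalRing.maximalIdeal A ∧
    ∃ d : ℕ, ringKrullDim A = d ∧
      Filter.Tendsto
        (fun n : ℕ => (d.factorial : ℝ) * ((Module.length A (A ⧸ I ^ n)).toNat : ℝ) / (n : ℝ) ^ d)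
        Filter.atTop (nhds (e : ℝ))

/-- A Gorenstein local ring: Noetherian, local, and of finite injective dimension over itself. -/
def IsGorensteinLocalRing (R : Type*) [CommRing R] : Prop :=
  IsNoetherianRing R ∧ IsLocalRing R ∧
    ∃ n : ℕ, HasInjectiveDimensionLE (ModuleCat.of R R) n

-- Let `S` be the set of `f` in the total ring of fractions `Q(A)` with `𝔪ᵏ f ⊆ A` for some `k`
-- (`sectionModule`): a subring containing `A`, the sections over the punctured spectrum. Since `𝔪`
-- contains a regular element, `H¹_𝔪(A) = S/A`, so `𝔠 = {r ∣ rS ⊆ A}`, and `𝔠` is also an ideal of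
-- `S`. The `d`-sequence property gives `aᵢS ⊆ A`, hence `𝔮 ⊆ 𝔠` and `S` is a finite `A`-module. The
-- vanishing of the other local cohomology makes `S` Cohen–Macaulay, and `a` is `S`-regular in every
-- order. It follows that `(a_j ∣ j ≠ i) : aᵢ = (a_j ∣ j ≠ i)S`, and summing over `i` gives `Σ̃ =
-- 𝔮S` (`map_sigmaTilde`). Condition 1 thus says `𝔮S = 𝔠`.
--
-- Type one means that `S/A` has simple socle. Being of finite length, it then has the length of `A`
-- modulo its annihilator, so `ℓ(S/A) = ℓ(A/𝔠)` and `ℓ(S/𝔠) = 2ℓ(A/𝔠)`. If `𝔮` is a reduction of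
-- `𝔠`, then `e_𝔠(A) = ℓ(S/𝔮S)`, by comparing `A/𝔠ⁿ` with `S/𝔮ⁿ⁺¹S` (`hasMultiplicity_annH1`). As
-- `𝔮S ⊆ 𝔠`, the equality `𝔮S = 𝔠` amounts to equality of these two lengths. Conversely `𝔮S = 𝔠`
-- gives `𝔠² = 𝔮S𝔠 = 𝔮𝔠`, so `𝔮` is a reduction.
--
-- For the last part, `Ã = S`. With `𝔟 = (a₁, …, a_{d-1})S ⊆ A` and `B = A/𝔟`, the element `a_d` is
-- regular on `B`. When `𝔠 = 𝔮S`, an element of the socle of `B/a_dB` has the form `a_d g` modulo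
-- `𝔟`, where `g` represents a socle element of `S/A`. Hence `B/a_dB` is Artinian with simple socle,
-- so self-injective, and `B` has injective dimension at most one.
--
-- Local cohomology enters through an elementwise criterion: `r` kills `Hⁿ_𝔪(M)`, `n ≥ 1`, when `r`
-- times each class in `Extⁿ(A/𝔪ᵏ, M)` dies in `Extⁿ(A/𝔪ˡ, M)` for some `l ≥ k`. Long exact
-- sequences of `Ext` then apply directly.

universe u

/-! ### Cocycles for Ext and an elementwise description of local cohomology. -/

noncomputable section

open Limits Opposite

variable {R : Type u} [CommRing R]

namespace CategoryTheory.ProjectiveResolution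

/-- The map induced on `Hom(-, Y)` by a morphism of chain complexes. -/
def linearYonedaMap {K L : ChainComplex (ModuleCat.{u} R) ℕ} (φ : K ⟶ L) (Y : ModuleCat.{u} R) :
    L.linearYonedaObj R Y ⟶ K.linearYonedaObj R Y :=
  (HomologicalComplex.unopFunctor (ModuleCat.{u} R) (ComplexShape.down ℕ)).map
    ((((linearYoneda R (ModuleCat.{u} R)).obj Y).rightOp.mapHomologicalComplex _).map φ).op

lemma comp_trans_naturality {C : Type*} [Category* C] {X₁ X₂ X₃ Y₁ Y₂ Y₃ : C} {x : X₁ ⟶ Y₁}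
    {y : X₂ ⟶ Y₂} {z : X₃ ⟶ Y₃} {a : X₁ ⟶ X₂} {b : X₂ ⟶ X₃} {a' : Y₁ ⟶ Y₂} {b' : Y₂ ⟶ Y₃}
    (h₁ : x ≫ a' = a ≫ y) (h₂ : y ≫ b' = b ≫ z) : x ≫ a' ≫ b' = (a ≫ b) ≫ z := by
  rw [reassoc_of% h₁, h₂, Category.assoc]

/-- The transition maps of local cohomology are pullbacks in the first variable of `Ext`; this
identifies them with precomposition on cocycles. It is the opposite of naturality for left derived
functors, combined with naturality of homology in the opposite category. -/
lemma isoExt_naturality {X X' Y : ModuleCat.{u} R} (g : X' ⟶ X) (P : ProjectiveResolution X)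
    (P' : ProjectiveResolution X') (φ : P'.complex ⟶ P.complex)
    (comm : φ.f 0 ≫ P.π.f 0 = P'.π.f 0 ≫ g) (n : ℕ) :
    ((Ext R (ModuleCat.{u} R) n).map g.op).app Y ≫ (P'.isoExt (R := R) n Y).hom =
      (P.isoExt n Y).hom ≫ HomologicalComplex.homologyMap (linearYonedaMap φ Y) n := by
  have h := congrArg Quiver.Hom.unop
    (ProjectiveResolution.isoLeftDerivedObj_inv_naturality g P' P φ comm
      ((linearYoneda R (ModuleCat.{u} R)).obj Y).rightOp n)
  have h2 := congrArg Quiver.Hom.unop (ShortComplex.homologyOpIso_inv_naturality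
    ((HomologicalComplex.shortComplexFunctor _ _ n).map (linearYonedaMap φ Y)))
  exact comp_trans_naturality h h2.symm


variable {X X' Y : ModuleCat.{u} R}

lemma exact_iCycles {K : CochainComplex (ModuleCat.{u} R) ℕ} (n : ℕ) :
    (ShortComplex.mk (K.iCycles n) (K.d n (n + 1)) (K.iCycles_d _ _)).Exact :=
  ShortComplex.exact_of_f_is_kernel _ (K.cyclesIsKernel n (n + 1) (by simp))

lemma exact_homologyπ {K : CochainComplex (ModuleCat.{u} R) ℕ} (n : ℕ) :
    (ShortComplex.mk (K.toCycles n (n + 1)) (K.homologyπ (n + 1))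
      (K.toCycles_comp_homologyπ _ _)).Exact :=
  ShortComplex.exact_of_g_is_cokernel _ (K.homologyIsCokernel n (n + 1) (by simp))

lemma iCycles_injective {K : CochainComplex (ModuleCat.{u} R) ℕ} (n : ℕ) :
    Function.Injective (K.iCycles n) :=
  (ModuleCat.mono_iff_injective _).mp inferInstance

/-- `ξ` is the class of the cocycle `f`. -/
def IsClassOf (P : ProjectiveResolution X) {n : ℕ} (f : P.complex.X n ⟶ Y)
    (ξ : ((Ext R (ModuleCat.{u} R) n).obj (op X)).obj Y) : Prop :=
  ∃ c : (P.complex.linearYonedaObj R Y).cycles n,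
    (P.complex.linearYonedaObj R Y).iCycles n c = f ∧
      (P.complex.linearYonedaObj R Y).homologyπ n c = (P.isoExt (R := R) n Y).hom ξ

variable {P : ProjectiveResolution X} {n : ℕ}

lemma IsClassOf.d_comp {f : P.complex.X n ⟶ Y}
    {ξ : ((Ext R (ModuleCat.{u} R) n).obj (op X)).obj Y} (h : IsClassOf P f ξ) :
    P.complex.d (n + 1) n ≫ f = 0 := by
  obtain ⟨c, rfl, -⟩ := h
  have := ConcreteCategory.congr_hom ((P.complex.linearYonedaObj R Y).iCycles_d n (n + 1)) c
  exact this

lemma IsClassOf.exists (ξ : ((Ext R (ModuleCat.{u} R) n).obj (op X)).obj Y) :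
    ∃ f : P.complex.X n ⟶ Y, IsClassOf P f ξ := by
  obtain ⟨c, hc⟩ := (ModuleCat.epi_iff_surjective
    ((P.complex.linearYonedaObj R Y).homologyπ n)).mp inferInstance
      ((P.isoExt (R := R) n Y).hom ξ)
  exact ⟨_, c, rfl, hc⟩

lemma IsClassOf.exists_of_cocycle (f : P.complex.X n ⟶ Y) (hf : P.complex.d (n + 1) n ≫ f = 0) :
    ∃ ξ : ((Ext R (ModuleCat.{u} R) n).obj (op X)).obj Y, IsClassOf P f ξ := by
  obtain ⟨c, hc⟩ := (ShortComplex.moduleCat_exact_iff _).mp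
    (exact_iCycles (K := P.complex.linearYonedaObj R Y) n) f hf
  refine ⟨(P.isoExt (R := R) n Y).inv ((P.complex.linearYonedaObj R Y).homologyπ n c), c, hc, ?_⟩
  simp

lemma IsClassOf.smul {f : P.complex.X n ⟶ Y} {ξ : ((Ext R (ModuleCat.{u} R) n).obj (op X)).obj Y}
    (h : IsClassOf P f ξ) (r : R) : IsClassOf P (r • f) (r • ξ) := by
  obtain ⟨c, rfl, hc⟩ := h
  exact ⟨r • c, map_smul _ _ _, by simp [hc]⟩

lemma IsClassOf.eq_zero_iff {f : P.complex.X (n + 1) ⟶ Y}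
    {ξ : ((Ext R (ModuleCat.{u} R) (n + 1)).obj (op X)).obj Y} (h : IsClassOf P f ξ) :
    ξ = 0 ↔ ∃ g : P.complex.X n ⟶ Y, P.complex.d (n + 1) n ≫ g = f := by
  obtain ⟨c, rfl, hc⟩ := h
  have h0 : ξ = 0 ↔ (P.complex.linearYonedaObj R Y).homologyπ (n + 1) c = 0 := by
    rw [hc]
    refine ⟨fun h ↦ by simp [h], fun h ↦ ?_⟩
    have := congrArg (P.isoExt (R := R) (n + 1) Y).inv h
    simpa using this
  rw [h0]
  constructor
  · intro h
    obtain ⟨g, hg⟩ := (ShortComplex.moduleCat_exact_iff _).mp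
      (exact_homologyπ (K := P.complex.linearYonedaObj R Y) n) c h
    refine ⟨g, ?_⟩
    have := ConcreteCategory.congr_hom
      ((P.complex.linearYonedaObj R Y).toCycles_i n (n + 1)) g
    rw [← hg]
    exact this.symm
  · rintro ⟨g, hg⟩
    have : c = (P.complex.linearYonedaObj R Y).toCycles n (n + 1) g := by
      apply iCycles_injective
      have := ConcreteCategory.congr_hom
        ((P.complex.linearYonedaObj R Y).toCycles_i n (n + 1)) g
      exact hg.symm.trans this.symm
    rw [this]
    exact ConcreteCategory.congr_hom
      ((P.complex.linearYonedaObj R Y).toCycles_comp_homologyπ n (n + 1)) g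

lemma IsClassOf.precomp {f : P.complex.X n ⟶ Y}
    {ξ : ((Ext R (ModuleCat.{u} R) n).obj (op X)).obj Y} (h : IsClassOf P f ξ)
    {P' : ProjectiveResolution X'} {g : X' ⟶ X} (φ : Hom P' P g) :
    IsClassOf P' (φ.hom.f n ≫ f) (((Ext R (ModuleCat.{u} R) n).map g.op).app Y ξ) := by
  obtain ⟨c, rfl, hc⟩ := h
  refine ⟨HomologicalComplex.cyclesMap (linearYonedaMap φ.hom Y) n c, ?_, ?_⟩
  · exact ConcreteCategory.congr_hom
      (HomologicalComplex.cyclesMap_i (linearYonedaMap φ.hom Y) n) c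
  · have h1 := ConcreteCategory.congr_hom
      (HomologicalComplex.homologyπ_naturality (linearYonedaMap φ.hom Y) n) c
    have h2 := ConcreteCategory.congr_hom (isoExt_naturality (Y := Y) g P P' φ.hom
      (by simpa using φ.hom_f_zero_comp_π_f_zero) n) ξ
    simp only [ConcreteCategory.comp_apply] at h1 h2
    rw [h2, ← hc]
    exact h1.symm

/-- Every morphism lifts to projective resolutions. -/
def homLift (P' : ProjectiveResolution X') (P : ProjectiveResolution X) (g : X' ⟶ X) :
    Hom P' P g where
  hom := lift g P' P
  hom_f_zero_comp_π_f_zero := by simpa using lift_commutes_zero g P' P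

lemma smul_extMk (f : P.complex.X n ⟶ Y) (hf : P.complex.d (n + 1) n ≫ f = 0) (r : R) :
    r • P.extMk f (n + 1) rfl hf = P.extMk (r • f) (n + 1) rfl (by simp [hf]) := by
  rw [Abelian.Ext.smul_eq_comp_mk₀, extMk_comp_mk₀]
  congr 1

end CategoryTheory.ProjectiveResolution

open ProjectiveResolution

/-- Local cohomology is built from the derived-functor `Ext`, while the long exact sequences concern
`Abelian.Ext`. Both are represented by cocycles on one projective resolution, and in both the
vanishing of `r` times a pullback means that the same cocycle is a coboundary. -/
lemma Ext.forall_exists_map_eq_zero_iff {D : Type*} {X Y : ModuleCat.{u} R} {Z : D → ModuleCat.{u} R}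
    (g : ∀ i, Z i ⟶ X) (n : ℕ) (r : R) :
    (∀ ξ : ((Ext R (ModuleCat.{u} R) (n + 1)).obj (op X)).obj Y,
      ∃ i, r • ((Ext R (ModuleCat.{u} R) (n + 1)).map (g i).op).app Y ξ = 0) ↔
    ∀ ξ : Abelian.Ext X Y (n + 1), ∃ i,
      r • (Abelian.Ext.mk₀ (g i)).comp ξ (zero_add _) = 0 := by
  let P := projectiveResolution X
  let Q i := projectiveResolution (Z i)
  have key (f : P.complex.X (n + 1) ⟶ Y) (ξ) (hξ : IsClassOf P f ξ) (i : D) :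
      r • ((Ext R (ModuleCat.{u} R) (n + 1)).map (g i).op).app Y ξ = 0 ↔
        r • (Abelian.Ext.mk₀ (g i)).comp (P.extMk f _ rfl hξ.d_comp) (zero_add _) = 0 := by
    rw [((hξ.precomp (homLift (Q i) P (g i))).smul r).eq_zero_iff,
      mk₀_comp_extMk _ _ _ _ (homLift (Q i) P (g i)), smul_extMk, extMk_eq_zero_iff _ _ _ _ _ n rfl]
  constructor
  · intro h ξ
    obtain ⟨f, hf, rfl⟩ := P.extMk_surjective ξ _ rfl
    obtain ⟨ξ, hξ⟩ := IsClassOf.exists_of_cocycle f hf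
    obtain ⟨i, hi⟩ := h ξ
    exact ⟨i, (key f ξ hξ i).mp hi⟩
  · intro h ξ
    obtain ⟨f, hf⟩ := IsClassOf.exists (P := P) ξ
    obtain ⟨i, hi⟩ := h (P.extMk f _ rfl hf.d_comp)
    exact ⟨i, (key f ξ hf i).mpr hi⟩

/-- In a filtered colimit every element comes from some stage, and an element that becomes zero is
already zero at a later stage. -/
lemma ModuleCat.smul_eq_zero_iff_of_isColimit {D : Type} [SmallCategory D] [IsFiltered D]
    {F : D ⥤ ModuleCat.{u} R} {c : Cocone F} (hc : IsColimit c) (r : R) :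
    r ∈ Module.annihilator R c.pt ↔
      ∀ (j : D) (y : F.obj j), ∃ (k : D) (f : j ⟶ k), r • F.map f y = 0 := by
  have : PreservesFilteredColimitsOfSize.{0, 0} (forget (ModuleCat.{u} R)) :=
    preservesFilteredColimitsOfSize_shrink _
  rw [Module.mem_annihilator]
  constructor
  · intro h j y
    have h1 : c.ι.app j (r • y) = c.ι.app j 0 := by rw [map_smul, h, map_zero]
    obtain ⟨k, f, g, hfg⟩ := (Concrete.isColimit_rep_eq_iff_exists (F := F) hc _ _).mp h1
    refine ⟨k, f, ?_⟩
    rw [← map_smul]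
    exact hfg.trans (map_zero _)
  · intro h x
    obtain ⟨j, y, rfl⟩ := Concrete.isColimit_exists_rep F hc x
    obtain ⟨k, f, hf⟩ := h j y
    rw [← c.w f, ModuleCat.comp_apply, ← map_smul, hf, map_zero]

/-- The projection `R ⧸ J ^ l → R ⧸ J ^ k` for `k ≤ l`. -/
def powQuotientMap (J : Ideal R) {k l : ℕ} (h : k ≤ l) :
    ModuleCat.of R (R ⧸ J ^ l) ⟶ ModuleCat.of R (R ⧸ J ^ k) :=
  ModuleCat.ofHom (Submodule.mapQ _ _ LinearMap.id (Ideal.pow_le_pow_right h))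

open localCohomology in
lemma mem_annihilator_localCohomology_iff (J : Ideal R) (n : ℕ) (M : ModuleCat.{u} R) (r : R) :
    r ∈ Module.annihilator R ((localCohomology J (n + 1)).obj M) ↔
      ∀ (k : ℕ) (ξ : Abelian.Ext (ModuleCat.of R (R ⧸ J ^ k)) M (n + 1)), ∃ l : {l // k ≤ l},
        r • (Abelian.Ext.mk₀ (powQuotientMap J l.2)).comp ξ (zero_add _) = 0 := by
  simp_rw [← Ext.forall_exists_map_eq_zero_iff]
  have : HasColimit (diagram (idealPowersDiagram J) (n + 1)) :=
    hasColimitDiagram.{u, 0} (idealPowersDiagram J) (n + 1)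
  refine (ModuleCat.smul_eq_zero_iff_of_isColimit
    (isColimitOfPreserves ((evaluation _ _).obj M)
      (colimit.isColimit (diagram (idealPowersDiagram J) (n + 1)))) r).trans ?_
  constructor
  · intro h k ξ
    obtain ⟨⟨⟨j⟩⟩, f, hf⟩ := h (op (op k)) ξ
    exact ⟨⟨j, f.unop.unop.down.down⟩, hf⟩
  · rintro h ⟨⟨k⟩⟩ ξ
    obtain ⟨l, hl⟩ := h k ξ
    exact ⟨op (op l), (homOfLE l.2).op.op, hl⟩

/-- Every class in `Ext ^ n (R ⧸ J ^ k, M)` dies in `Ext ^ n (R ⧸ J ^ l, M)` for some `l ≥ k`. -/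
def ExtPowVanishes (J : Ideal R) (n : ℕ) (M : ModuleCat.{u} R) : Prop :=
  ∀ (k : ℕ) (ξ : Abelian.Ext (ModuleCat.of R (R ⧸ J ^ k)) M n), ∃ l : {l // k ≤ l},
    (Abelian.Ext.mk₀ (powQuotientMap J l.2)).comp ξ (zero_add _) = 0

lemma extPowVanishes_of_subsingleton_localCohomology {J : Ideal R} {n : ℕ} {M : ModuleCat.{u} R}
    (h : Subsingleton ((localCohomology J (n + 1)).obj M)) : ExtPowVanishes J (n + 1) M := by
  rw [← Module.annihilator_eq_top_iff (R := R), Ideal.eq_top_iff_one,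
    mem_annihilator_localCohomology_iff] at h
  intro k ξ
  simpa only [one_smul] using h k ξ

end

/-! ### Exact sequences for the vanishing of local cohomology, and torsion modules. -/

noncomputable section

open Limits Opposite
open Abelian

variable {R : Type u} [CommRing R]

lemma powQuotientMap_comp (J : Ideal R) {k l j : ℕ} (h : k ≤ l) (h' : l ≤ j) :
    powQuotientMap J h' ≫ powQuotientMap J h = powQuotientMap J (h.trans h') := by
  ext
  rfl

lemma mk₀_powQuotientMap_comp_comp {J : Ideal R} {k l j n : ℕ} (h : k ≤ l) (h' : l ≤ j)
    {M : ModuleCat.{u} R} (ξ : Ext (ModuleCat.of R (R ⧸ J ^ k)) M n) :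
    (Ext.mk₀ (powQuotientMap J h')).comp
      ((Ext.mk₀ (powQuotientMap J h)).comp ξ (zero_add _)) (zero_add _) =
      (Ext.mk₀ (powQuotientMap J (h.trans h'))).comp ξ (zero_add _) := by
  rw [Ext.mk₀_comp_mk₀_assoc, powQuotientMap_comp]

namespace ExtPowVanishes

variable {J : Ideal R} {n : ℕ} {S : ShortComplex (ModuleCat.{u} R)}

/-- The long exact sequence of `Ext(R ⧸ J ^ k, -)`: enlarge the power once so that the obstruction
class dies and the class lifts, then once more so that the lift dies. The two lemmas below follow
the same pattern. -/
lemma third (hS : S.ShortExact) (h₂ : ExtPowVanishes J n S.X₂)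
    (h₁ : ExtPowVanishes J (n + 1) S.X₁) : ExtPowVanishes J n S.X₃ := by
  intro k ξ
  obtain ⟨⟨l, hl⟩, h⟩ := h₁ k (ξ.comp hS.extClass rfl)
  rw [← Ext.comp_assoc _ _ _ (zero_add n) rfl (by lia)] at h
  obtain ⟨η, hη⟩ := Ext.covariant_sequence_exact₃ _ hS _ _ h
  obtain ⟨⟨j, hj⟩, h'⟩ := h₂ l η
  refine ⟨⟨j, hl.trans hj⟩, ?_⟩
  rw [← mk₀_powQuotientMap_comp_comp hl hj, ← hη,
    ← Ext.comp_assoc _ _ _ (zero_add n) (add_zero n) (by lia), h', Ext.zero_comp]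

lemma second (hS : S.ShortExact) (h₁ : ExtPowVanishes J n S.X₁)
    (h₃ : ExtPowVanishes J n S.X₃) : ExtPowVanishes J n S.X₂ := by
  intro k ξ
  obtain ⟨⟨l, hl⟩, h⟩ := h₃ k (ξ.comp (Ext.mk₀ S.g) (add_zero _))
  rw [← Ext.comp_assoc _ _ _ (zero_add n) (add_zero n) (by lia)] at h
  obtain ⟨η, hη⟩ := Ext.covariant_sequence_exact₂ _ hS _ h
  obtain ⟨⟨j, hj⟩, h'⟩ := h₁ l η
  refine ⟨⟨j, hl.trans hj⟩, ?_⟩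
  rw [← mk₀_powQuotientMap_comp_comp hl hj, ← hη,
    ← Ext.comp_assoc _ _ _ (zero_add n) (add_zero n) (by lia), h', Ext.zero_comp]

lemma first (hS : S.ShortExact) (h₃ : ExtPowVanishes J n S.X₃)
    (h₂ : ∀ X, Subsingleton (Ext X S.X₂ (n + 1))) : ExtPowVanishes J (n + 1) S.X₁ := by
  intro k ξ
  obtain ⟨η, rfl⟩ := Ext.covariant_sequence_exact₁ _ hS ξ (Subsingleton.elim _ _) rfl
  obtain ⟨l, h⟩ := h₃ k η
  refine ⟨l, ?_⟩
  rw [← Ext.comp_assoc _ _ _ (zero_add n) rfl (by lia), h, Ext.zero_comp]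

end ExtPowVanishes

/-- The submodule of elements killed by a power of `J`. -/
def powTorsion (J : Ideal R) (M : Type*) [AddCommGroup M] [Module R M] : Submodule R M where
  carrier := {x | ∃ k : ℕ, ∀ r ∈ J ^ k, r • x = 0}
  add_mem' := by
    rintro x y ⟨k, hk⟩ ⟨l, hl⟩
    refine ⟨k + l, fun r hr ↦ ?_⟩
    rw [smul_add, hk r (Ideal.pow_le_pow_right (by lia) hr),
      hl r (Ideal.pow_le_pow_right (by lia) hr), add_zero]
  zero_mem' := ⟨0, by simp⟩
  smul_mem' := by
    rintro c x ⟨k, hk⟩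
    exact ⟨k, fun r hr ↦ by rw [smul_comm, hk r hr, smul_zero]⟩

lemma mem_powTorsion {J : Ideal R} {M : Type*} [AddCommGroup M] [Module R M] {x : M} :
    x ∈ powTorsion J M ↔ ∃ k : ℕ, ∀ r ∈ J ^ k, r • x = 0 := Iff.rfl

lemma exists_pow_smul_eq_zero_of_fg {J : Ideal R} {M N : Type*} [AddCommGroup M] [Module R M]
    [AddCommGroup N] [Module R N] [Module.Finite R N] (hM : powTorsion J M = ⊤) (f : N →ₗ[R] M) :
    ∃ k : ℕ, ∀ r ∈ J ^ k, ∀ x, r • f x = 0 := by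
  obtain ⟨s, hs⟩ := Module.Finite.fg_top (R := R) (M := N)
  have h (x : N) : ∃ k : ℕ, ∀ r ∈ J ^ k, r • f x = 0 := by
    have : f x ∈ powTorsion J M := hM ▸ Submodule.mem_top
    exact this
  choose k hk using h
  refine ⟨s.sup k, fun r hr x ↦ ?_⟩
  have hx : x ∈ Submodule.span R (s : Set N) := hs ▸ Submodule.mem_top
  induction hx using Submodule.span_induction with
  | mem x hx => exact hk x r (Ideal.pow_le_pow_right (Finset.le_sup (f := k) hx) hr)
  | zero => simp
  | add x y _ _ h1 h2 => simp [h1, h2]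
  | smul c x _ h1 => rw [map_smul, smul_comm, h1, smul_zero]

/-- Over a Noetherian ring, the `J`-power torsion of an injective module is injective. -/
lemma baer_powTorsion [IsNoetherianRing R] (J : Ideal R) {E : Type u} [AddCommGroup E] [Module R E]
    (hE : Module.Baer R E) : Module.Baer R (powTorsion J E) := by
  intro I f
  have htop : powTorsion J (powTorsion J E) = ⊤ := by
    rw [eq_top_iff]
    rintro ⟨x, k, hk⟩ -
    exact ⟨k, fun r hr ↦ Subtype.ext (hk r hr)⟩
  obtain ⟨k, hk⟩ := exists_pow_smul_eq_zero_of_fg htop f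
  -- By Artin–Rees `I ∩ J ^ (k + c) ⊆ J ^ k I`, on which `f` vanishes.
  obtain ⟨c, hc⟩ := Ideal.exists_pow_inf_eq_pow_smul J I
  have hcap (x : R) (hx : x ∈ J ^ (k + c)) (hxI : x ∈ I) : f ⟨x, hxI⟩ = 0 := by
    have h1 : x ∈ J ^ k • (J ^ c • (⊤ : Submodule R R) ⊓ I) := by
      have := hc (k + c) (by lia)
      rw [Nat.add_sub_cancel] at this
      rw [← this]
      exact ⟨by simpa using hx, hxI⟩
    have h2 : J ^ k • I ≤ (LinearMap.ker f).map I.subtype := by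
      refine Submodule.smul_le.mpr fun r hr m hm ↦ ⟨r • ⟨m, hm⟩, ?_, rfl⟩
      rw [SetLike.mem_coe, LinearMap.mem_ker, map_smul, hk r hr]
    have h3 : J ^ k • (J ^ c • (⊤ : Submodule R R) ⊓ I) ≤ J ^ k • I :=
      smul_mono_right _ inf_le_right
    obtain ⟨y, hy, rfl⟩ := h2 (h3 h1)
    exact hy
  let K : Ideal R := J ^ (k + c)
  let q : I →ₗ[R] R ⧸ K := K.mkQ ∘ₗ I.subtype
  have hq : LinearMap.ker q ≤ LinearMap.ker ((powTorsion J E).subtype ∘ₗ f) := by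
    rintro ⟨x, hx⟩ h
    have h' : x ∈ K := by simpa [q, Ideal.Quotient.eq_zero_iff_mem] using h
    simp [hcap x h' hx]
  -- So `f` factors through the image of `I` in `R ⧸ K`. Extend it to a map `R ⧸ K → E`; the image
  -- of `1` is killed by `K`, hence lies in the torsion part.
  obtain ⟨g, hg⟩ := (Module.Baer.injective hE).out ((LinearMap.ker q).liftQ q le_rfl)
    (LinearMap.ker_eq_bot.mp (Submodule.ker_liftQ_eq_bot _ _ _ le_rfl))
    ((LinearMap.ker q).liftQ _ hq)
  have hg1 : g (K.mkQ 1) ∈ powTorsion J E :=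
    ⟨k + c, fun r hr ↦ by
      rw [← map_smul, ← map_smul, smul_eq_mul, mul_one, Submodule.mkQ_apply,
        (Submodule.Quotient.mk_eq_zero K).mpr hr, map_zero]⟩
  refine ⟨LinearMap.toSpanSingleton R _ ⟨_, hg1⟩, fun x hx ↦ Subtype.ext ?_⟩
  have := hg (Submodule.Quotient.mk ⟨x, hx⟩)
  rw [Submodule.liftQ_apply, Submodule.liftQ_apply] at this
  simp only [LinearMap.toSpanSingleton_apply, SetLike.val_smul]
  rw [← map_smul, ← map_smul, smul_eq_mul, mul_one]
  exact this

lemma shortExact_of_exact {M N P : Type u} [AddCommGroup M] [Module R M] [AddCommGroup N]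
    [Module R N] [AddCommGroup P] [Module R P] {f : M →ₗ[R] N} {g : N →ₗ[R] P}
    (hf : Function.Injective f) (hg : Function.Surjective g) (h : Function.Exact f g) :
    (ShortComplex.mk (ModuleCat.ofHom f) (ModuleCat.ofHom g)
      (by ext x; exact h.apply_apply_eq_zero x)).ShortExact where
  exact := (ShortComplex.moduleCat_exact_iff _).mpr fun x hx ↦ (h x).mp hx
  mono_f := (ModuleCat.mono_iff_injective _).mpr hf
  epi_g := (ModuleCat.epi_iff_surjective _).mpr hg

/-- The morphism from `R ⧸ I` determined by an element killed by `I`. -/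
def homOfMem (I : Ideal R) {M : Type u} [AddCommGroup M] [Module R M] (x : M)
    (hx : ∀ r ∈ I, r • x = 0) : ModuleCat.of R (R ⧸ I) ⟶ ModuleCat.of R M :=
  ModuleCat.ofHom (Submodule.liftQ I (LinearMap.toSpanSingleton R M x) hx)

lemma hom_ext_of_one {I : Ideal R} {M : ModuleCat.{u} R} {f g : ModuleCat.of R (R ⧸ I) ⟶ M}
    (h : f (Submodule.Quotient.mk (1 : R)) = g (Submodule.Quotient.mk (1 : R))) : f = g := by
  apply ModuleCat.hom_ext
  apply Submodule.linearMap_qext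
  apply LinearMap.ext_ring
  exact h

lemma homOfMem_one (I : Ideal R) {M : Type u} [AddCommGroup M] [Module R M] (x : M)
    (hx : ∀ r ∈ I, r • x = 0) : homOfMem I x hx (Submodule.Quotient.mk (1 : R)) = x := by
  exact (Submodule.liftQ_apply I (LinearMap.toSpanSingleton R M x) (h := hx) 1).trans (one_smul R x)

lemma smul_hom_mk_one {I : Ideal R} {M : ModuleCat.{u} R} (f : ModuleCat.of R (R ⧸ I) ⟶ M)
    {r : R} (hr : r ∈ I) : r • f (Submodule.Quotient.mk (1 : R)) = 0 := by
  rw [← map_smul, ← Submodule.Quotient.mk_smul, smul_eq_mul, mul_one]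
  have : (Submodule.Quotient.mk r : R ⧸ I) = 0 := (Submodule.Quotient.mk_eq_zero I).mpr hr
  rw [this]
  exact map_zero f.hom

/-- Modules all of whose elements are killed by powers of `J` have no higher local cohomology. -/
lemma extPowVanishes_of_powTorsion_eq_top [IsNoetherianRing R] {J : Ideal R} (n : ℕ) {N : Type u}
    [AddCommGroup N] [Module R N] (hN : powTorsion J N = ⊤) :
    ExtPowVanishes J (n + 1) (ModuleCat.of R N) := by
  induction n generalizing N with
  | zero | succ n ih
  all_goals
    let E : ModuleCat.{u} R := Injective.under (ModuleCat.of R N)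
    let i : N →ₗ[R] E := (Injective.ι (ModuleCat.of R N)).hom
    have hi : Function.Injective i := (ModuleCat.mono_iff_injective _).mp inferInstance
    have hE : Module.Baer R E := Module.Baer.of_injective
      ((Module.injective_iff_injective_object R E).mpr
        (Injective.injective_under (ModuleCat.of R N)))
    have hT := baer_powTorsion J hE
    let f : N →ₗ[R] powTorsion J E := i.codRestrict _ fun x ↦ by
      obtain ⟨k, hk⟩ : x ∈ powTorsion J N := hN ▸ Submodule.mem_top
      exact ⟨k, fun r hr ↦ by rw [← map_smul, hk r hr, map_zero]⟩
    have hf : Function.Injective f := fun x y h ↦ hi (congrArg Subtype.val h)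
    have hS := shortExact_of_exact hf (Submodule.mkQ_surjective (LinearMap.range f))
      (LinearMap.exact_map_mkQ_range f)
    have hinj : Injective (ModuleCat.of R (powTorsion J E)) :=
      (Module.injective_iff_injective_object R _).mp (Module.Baer.injective hT)
    have hext (n : ℕ) (X) : Subsingleton (Ext X (ModuleCat.of R (powTorsion J E)) (n + 1)) :=
      subsingleton_of_forall_eq 0 Ext.eq_zero_of_injective
  -- Degree one: `ξ` is the connecting class of some `φ : R ⧸ J ^ k → T ⧸ N`, with `T` the torsion
  -- of the injective hull-like module `E`. A lift `t` of `φ 1` is killed by `J ^ l`, so `φ` lifts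
  -- to `T` after pullback to `R ⧸ J ^ (k + l)` and its connecting class vanishes there.
  · intro k ξ
    obtain ⟨η, rfl⟩ := Ext.covariant_sequence_exact₁ _ hS ξ
      (@Subsingleton.elim _ (hext 0 _) _ _) rfl
    obtain ⟨φ, rfl⟩ := (Ext.mk₀_bijective _ _).2 η
    obtain ⟨t, ht⟩ := Submodule.mkQ_surjective _ (φ (Submodule.Quotient.mk (1 : R)))
    obtain ⟨l, hl⟩ := t.2
    refine ⟨⟨k + l, by lia⟩, ?_⟩
    have hφ : powQuotientMap J (Nat.le_add_right k l) ≫ φ =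
        homOfMem (J ^ (k + l)) t (fun r hr ↦
          Subtype.ext (hl r (Ideal.pow_le_pow_right (by lia) hr))) ≫
            ModuleCat.ofHom (Submodule.mkQ (LinearMap.range f)) := by
      apply hom_ext_of_one
      rw [ModuleCat.comp_apply, ModuleCat.comp_apply, homOfMem_one]
      exact ht.symm
    rw [← Ext.comp_assoc _ _ _ (zero_add 0) rfl (by lia), Ext.mk₀_comp_mk₀, hφ,
      ← Ext.mk₀_comp_mk₀, Ext.comp_assoc _ _ _ (zero_add 0) (zero_add 1) (by lia)]
    have := hS.comp_extClass
    dsimp at this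
    rw [this, Ext.comp_zero]
  -- Dimension shift: the quotient of the torsion part of `E` by `N` is again torsion.
  · refine ExtPowVanishes.first hS (ih ?_) (hext _)
    rw [eq_top_iff]
    rintro x -
    obtain ⟨⟨x, k, hk⟩, rfl⟩ := Submodule.mkQ_surjective _ x
    refine ⟨k, fun r hr ↦ ?_⟩
    rw [← map_smul]
    have : r • (⟨x, k, hk⟩ : powTorsion J E) = 0 := Subtype.ext (hk r hr)
    rw [this, map_zero]

end

/-! ### First local cohomology of a submodule on whose ambient module a ring element acts
bijectively. -/

noncomputable section

open Limits Opposite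
open Abelian

variable {R : Type u} [CommRing R]

/-- Multiplication by `a` on `Ext` is zero when computed through `X` and bijective when computed
through `Y`. -/
lemma Ext.eq_zero_of_smul_bijective {X Y : ModuleCat.{u} R} {a : R} (hX : ∀ x : X, a • x = 0)
    (hY : Function.Bijective fun y : Y ↦ a • y) {n : ℕ} (ξ : Ext X Y n) : ξ = 0 := by
  have h1 : a • ξ = 0 := by
    have : a • 𝟙 X = 0 := by
      ext x
      exact hX x
    rw [← Ext.mk₀_id_comp ξ, ← Ext.smul_comp, ← Ext.mk₀_smul, this, Ext.mk₀_zero, Ext.zero_comp]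
  have : IsIso (a • 𝟙 Y) := by
    have h2 : ⇑(a • 𝟙 Y) = fun y : Y ↦ a • y := rfl
    have := (ModuleCat.mono_iff_injective (a • 𝟙 Y)).mpr (h2 ▸ hY.1)
    have := (ModuleCat.epi_iff_surjective (a • 𝟙 Y)).mpr (h2 ▸ hY.2)
    exact isIso_of_mono_of_epi _
  rw [Ext.smul_eq_comp_mk₀] at h1
  rw [← Ext.comp_mk₀_id ξ, ← IsIso.hom_inv_id (a • 𝟙 Y), ← Ext.mk₀_comp_mk₀,
    ← Ext.comp_assoc _ _ _ (add_zero n) (add_zero 0) (by lia), h1, Ext.zero_comp]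

section Embedding

/-- For a short exact sequence with `Ext ^ n (X, X₂) = 0` for all `n`, the connecting isomorphism
`Hom (X, X₃) ≃ Ext ^ 1 (X, X₁)`. -/
def connectingEquiv {S : ShortComplex (ModuleCat.{u} R)} (hS : S.ShortExact) {X : ModuleCat.{u} R}
    (hX : ∀ n, ∀ ξ : Ext X S.X₂ n, ξ = 0) : (X ⟶ S.X₃) ≃ₗ[R] Ext X S.X₁ 1 :=
  (Ext.linearEquiv₀ (R := R)).symm.trans
    (LinearEquiv.ofBijective (Ext.postcompOfLinear hS.extClass R X (zero_add 1)) ⟨by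
      refine (injective_iff_map_eq_zero _).mpr fun η hη ↦ ?_
      obtain ⟨ξ, rfl⟩ := Ext.covariant_sequence_exact₃ _ hS η (zero_add 1) hη
      rw [hX 0 ξ, Ext.zero_comp],
      fun ξ ↦ Ext.covariant_sequence_exact₁ _ hS ξ (hX 1 _) (zero_add 1)⟩)

lemma comp_connectingEquiv {S : ShortComplex (ModuleCat.{u} R)} (hS : S.ShortExact)
    {X X' : ModuleCat.{u} R} (hX : ∀ n, ∀ ξ : Ext X S.X₂ n, ξ = 0)
    (hX' : ∀ n, ∀ ξ : Ext X' S.X₂ n, ξ = 0) (f : X ⟶ S.X₃) (g : X' ⟶ X) :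
    (Ext.mk₀ g).comp (connectingEquiv hS hX f) (zero_add 1) = connectingEquiv hS hX' (g ≫ f) := by
  change (Ext.mk₀ g).comp ((Ext.mk₀ f).comp hS.extClass (zero_add 1)) (zero_add 1) =
    (Ext.mk₀ (g ≫ f)).comp hS.extClass (zero_add 1)
  rw [Ext.mk₀_comp_mk₀_assoc]

variable {M Q : Type u} [AddCommGroup M] [Module R M] [AddCommGroup Q] [Module R Q]
  {i : M →ₗ[R] Q} {J : Ideal R} {a : R}

lemma embedding_shortExact (hi : Function.Injective i) :
    (ShortComplex.mk (ModuleCat.ofHom i) (ModuleCat.ofHom (LinearMap.range i).mkQ)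
      (by ext x; exact (LinearMap.exact_map_mkQ_range i).apply_apply_eq_zero x)).ShortExact :=
  shortExact_of_exact hi (Submodule.mkQ_surjective (LinearMap.range i))
      (LinearMap.exact_map_mkQ_range i)

lemma ext_powQuotient_eq_zero (ha : a ∈ J) (hQ : Function.Bijective fun y : Q ↦ a • y)
    (k n : ℕ) (ξ : Ext (ModuleCat.of R (R ⧸ J ^ k)) (ModuleCat.of R Q) n) :
    ξ = 0 := by
  refine Ext.eq_zero_of_smul_bijective (a := a ^ k) (fun x ↦ ?_) ?_ ξ
  · obtain ⟨x, rfl⟩ := Submodule.mkQ_surjective _ x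
    rw [← map_smul, Submodule.mkQ_apply]
    exact (Submodule.Quotient.mk_eq_zero _).mpr (Ideal.mul_mem_right _ _ (Ideal.pow_mem_pow ha k))
  · have : (fun y : Q ↦ a ^ k • y) = (fun y : Q ↦ a • y)^[k] := by
      rw [smul_iterate]
    change Function.Bijective (fun y : Q ↦ a ^ k • y)
    rw [this]
    exact hQ.iterate k

/-- The annihilator of the first local cohomology of `M ⊆ Q`. -/
lemma forall_smul_ext_eq_zero_iff (ha : a ∈ J) (hi : Function.Injective i)
    (hQ : Function.Bijective fun y : Q ↦ a • y) (r : R) :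
    (∀ (k : ℕ) (ξ : Ext (ModuleCat.of R (R ⧸ J ^ k)) (ModuleCat.of R M) 1), ∃ l : {l // k ≤ l},
      r • (Ext.mk₀ (powQuotientMap J l.2)).comp ξ (zero_add _) = 0) ↔
      ∀ (q : Q) (k : ℕ), (∀ s ∈ J ^ k, s • q ∈ LinearMap.range i) → r • q ∈ LinearMap.range i := by
  have hz (k : ℕ) := ext_powQuotient_eq_zero ha hQ k
  constructor
  · intro h q k hq
    have hq' : ∀ s ∈ J ^ k, s • (LinearMap.range i).mkQ q = 0 := fun s hs ↦ by
      rw [← map_smul, Submodule.mkQ_apply]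
      exact (Submodule.Quotient.mk_eq_zero _).mpr (hq s hs)
    obtain ⟨l, hl⟩ := h k (connectingEquiv (embedding_shortExact hi) (hz k) (homOfMem _ _ hq'))
    rw [comp_connectingEquiv (embedding_shortExact hi) _ (hz l), ← map_smul, LinearEquiv.map_eq_zero_iff] at hl
    -- The projection `R ⧸ J ^ l → R ⧸ J ^ k` sends `1` to `1`, so enlarging the power does not
    -- change the element of `Q ⧸ M`.
    have h1 := ConcreteCategory.congr_hom hl (Submodule.Quotient.mk (1 : R))
    have h2 : r • homOfMem _ _ hq' (Submodule.Quotient.mk (1 : R)) = 0 := h1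
    rw [homOfMem_one, ← map_smul, Submodule.mkQ_apply] at h2
    exact (Submodule.Quotient.mk_eq_zero _).mp h2
  · intro h k ξ
    refine ⟨⟨k, le_rfl⟩, ?_⟩
    obtain ⟨f, rfl⟩ := (connectingEquiv (embedding_shortExact hi) (hz k)).surjective ξ
    obtain ⟨q, hq⟩ := Submodule.mkQ_surjective _ (f (Submodule.Quotient.mk (1 : R)))
    have hrf : r • f = 0 := by
      apply hom_ext_of_one
      change r • f (Submodule.Quotient.mk (1 : R)) = 0
      rw [← hq, ← map_smul, Submodule.mkQ_apply]
      refine (Submodule.Quotient.mk_eq_zero _).mpr (h q k fun s hs ↦ ?_)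
      rw [← Submodule.Quotient.mk_eq_zero, ← Submodule.mkQ_apply, map_smul, hq]
      exact smul_hom_mk_one f hs
    rw [comp_connectingEquiv (embedding_shortExact hi) _ (hz k), ← map_smul, ← Linear.comp_smul, hrf, comp_zero, map_zero]

lemma extPowVanishes_one (ha : a ∈ J) (hi : Function.Injective i)
    (hQ : Function.Bijective fun y : Q ↦ a • y) (h : ∀ (q : Q) (k : ℕ), (∀ s ∈ J ^ k, s • q ∈ LinearMap.range i) →
    q ∈ LinearMap.range i) : ExtPowVanishes J 1 (ModuleCat.of R M) := by
  intro k ξ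
  simpa only [one_smul] using (forall_smul_ext_eq_zero_iff ha hi hQ 1).mpr (by simpa using h) k ξ

/-- If `Ext ^ 1 (R ⧸ J, M)` is simple, so is the socle of `Q ⧸ M`. -/
lemma exists_socle_of_length_ext_eq_one (ha : a ∈ J) (hi : Function.Injective i)
    (hQ : Function.Bijective fun y : Q ↦ a • y)
    (h : Module.length R (Ext (ModuleCat.of R (R ⧸ J)) (ModuleCat.of R M) 1) = 1) :
    (∃ q, q ∉ LinearMap.range i ∧ ∀ s ∈ J, s • q ∈ LinearMap.range i) ∧
      ∀ q q', q ∉ LinearMap.range i → (∀ s ∈ J, s • q ∈ LinearMap.range i) →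
        (∀ s ∈ J, s • q' ∈ LinearMap.range i) → ∃ r : R, q' - r • q ∈ LinearMap.range i := by
  have hz (n : ℕ) (ξ : Ext (ModuleCat.of R (R ⧸ J)) (ModuleCat.of R Q) n) : ξ = 0 :=
    Ext.eq_zero_of_smul_bijective (a := a) (fun x ↦ by
      obtain ⟨x, rfl⟩ := Submodule.mkQ_surjective _ x
      rw [← map_smul, Submodule.mkQ_apply]
      exact (Submodule.Quotient.mk_eq_zero _).mpr (Ideal.mul_mem_right _ _ ha)) hQ ξ
  rw [← (connectingEquiv (embedding_shortExact hi) hz).length_eq, Module.length_eq_one_iff] at h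
  have hmem {q : Q} (hq : ∀ s ∈ J, s • q ∈ LinearMap.range i) :
      ∀ s ∈ J, s • (LinearMap.range i).mkQ q = 0 := fun s hs ↦ by
    rw [← map_smul, Submodule.mkQ_apply]
    exact (Submodule.Quotient.mk_eq_zero _).mpr (hq s hs)
  constructor
  · have := IsSimpleModule.nontrivial R
      (ModuleCat.of R (R ⧸ J) ⟶ ModuleCat.of R (Q ⧸ LinearMap.range i))
    obtain ⟨f, hf⟩ := exists_ne (0 : ModuleCat.of R (R ⧸ J) ⟶ ModuleCat.of R (Q ⧸ LinearMap.range i))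
    obtain ⟨q, hq⟩ := Submodule.mkQ_surjective _ (f (Submodule.Quotient.mk (1 : R)))
    refine ⟨q, fun h ↦ hf (hom_ext_of_one ?_), fun s hs ↦ ?_⟩
    · rw [← hq, Submodule.mkQ_apply, (Submodule.Quotient.mk_eq_zero _).mpr h]
      rfl
    · rw [← Submodule.Quotient.mk_eq_zero, ← Submodule.mkQ_apply, map_smul, hq]
      exact smul_hom_mk_one f hs
  · intro q q' h0 hq hq'
    have hne : homOfMem J _ (hmem hq) ≠ 0 := fun h ↦ h0 <| by
      rw [← Submodule.Quotient.mk_eq_zero, ← Submodule.mkQ_apply, ← homOfMem_one J _ (hmem hq), h]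
      rfl
    obtain ⟨r, hr⟩ := IsSimpleModule.toSpanSingleton_surjective R hne (homOfMem J _ (hmem hq'))
    refine ⟨r, ?_⟩
    have h1 : r • homOfMem J _ (hmem hq) (Submodule.Quotient.mk (1 : R)) =
      homOfMem J _ (hmem hq') (Submodule.Quotient.mk (1 : R)) := ConcreteCategory.congr_hom hr _
    rw [homOfMem_one, homOfMem_one] at h1
    rw [← Submodule.Quotient.mk_eq_zero, ← Submodule.mkQ_apply, map_sub, map_smul, h1, sub_self]

end Embedding

/-- Dividing out a regular element lowers the range of vanishing of local cohomology by one. -/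
lemma ExtPowVanishes.quotient {M : Type u} [AddCommGroup M] [Module R M] {J : Ideal R}
    {N N' : Submodule R M} {a : R} {n : ℕ} (hreg : ∀ z, a • z ∈ N → z ∈ N)
    (hN' : ∀ z, z ∈ N' ↔ ∃ w, z - a • w ∈ N)
    (h₀ : ExtPowVanishes J n (ModuleCat.of R (M ⧸ N)))
    (h₁ : ExtPowVanishes J (n + 1) (ModuleCat.of R (M ⧸ N))) :
    ExtPowVanishes J n (ModuleCat.of R (M ⧸ N')) := by
  have hle : N ≤ N' := fun z hz ↦ (hN' z).mpr ⟨0, by simpa⟩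
  let f : M ⧸ N →ₗ[R] M ⧸ N := LinearMap.lsmul R _ a
  let g : M ⧸ N →ₗ[R] M ⧸ N' := Submodule.factor hle
  have hf : Function.Injective f := by
    refine (injective_iff_map_eq_zero _).mpr fun z hz ↦ ?_
    obtain ⟨z, rfl⟩ := Submodule.mkQ_surjective _ z
    exact (Submodule.Quotient.mk_eq_zero _).mpr (hreg z ((Submodule.Quotient.mk_eq_zero _).mp hz))
  have hg : Function.Surjective g := Submodule.factor_surjective hle
  have hfg : Function.Exact f g := by
    intro z
    obtain ⟨z, rfl⟩ := Submodule.mkQ_surjective _ z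
    have h1 : g (N.mkQ z) = 0 ↔ z ∈ N' := Submodule.Quotient.mk_eq_zero _
    rw [h1, hN']
    constructor
    · rintro ⟨w, hw⟩
      refine ⟨N.mkQ w, ?_⟩
      exact ((Submodule.Quotient.eq N).mpr hw).symm
    · rintro ⟨w, hw⟩
      obtain ⟨w, rfl⟩ := Submodule.mkQ_surjective _ w
      exact ⟨w, (Submodule.Quotient.eq N).mp hw.symm⟩
  exact ExtPowVanishes.third (shortExact_of_exact hf hg hfg) h₀ h₁

end

/-! ### Permutably regular sequences and their Hilbert–Samuel function. -/

section

variable {R : Type u} [CommRing R]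

lemma mkQ_mem_smul_top_iff {M : Type*} [AddCommGroup M] [Module R M] (P : Submodule R M)
    (K : Ideal R) (z : M) :
    P.mkQ z ∈ K • (⊤ : Submodule R (M ⧸ P)) ↔ z ∈ K • (⊤ : Submodule R M) ⊔ P := by
  have h : K • (⊤ : Submodule R (M ⧸ P)) = (K • (⊤ : Submodule R M)).map P.mkQ := by
    rw [Submodule.map_smul'', Submodule.map_top, Submodule.range_mkQ]
  rw [h, ← Submodule.mem_comap, Submodule.comap_map_mkQ, sup_comm]

lemma length_quotient_smul_top {M : Type*} [AddCommGroup M] [Module R M] (P : Submodule R M)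
    (K : Ideal R) :
    Module.length R ((M ⧸ P) ⧸ (K • (⊤ : Submodule R (M ⧸ P)))) =
      Module.length R (M ⧸ (K • (⊤ : Submodule R M) ⊔ P)) := by
  have h : K • (⊤ : Submodule R (M ⧸ P)) = (K • (⊤ : Submodule R M) ⊔ P).map P.mkQ := by
    ext z
    obtain ⟨z, rfl⟩ := P.mkQ_surjective z
    rw [mkQ_mem_smul_top_iff, ← Submodule.mem_comap, Submodule.comap_map_mkQ]
    simp [sup_comm]
  rw [h]
  exact (Submodule.quotientQuotientEquivQuotient P _ le_sup_right).length_eq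

/-- A product of `n + 1` factors from `I ⊔ J` either uses a factor from `I` or lies in `J ^ (n +
1)`. -/
lemma sup_pow_succ_le (I J : Ideal R) (n : ℕ) :
    (I ⊔ J) ^ (n + 1) ≤ I * (I ⊔ J) ^ n ⊔ J ^ (n + 1) := by
  induction n with
  | zero => simp
  | succ n ih =>
    calc (I ⊔ J) ^ (n + 2) = I * (I ⊔ J) ^ (n + 1) ⊔ J * (I ⊔ J) ^ (n + 1) := by
          rw [pow_succ' _ (n + 1), Ideal.sup_mul]
      _ ≤ I * (I ⊔ J) ^ (n + 1) ⊔ J ^ (n + 2) := by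
          refine sup_le le_sup_left ((Ideal.mul_mono_right ih).trans ?_)
          rw [Ideal.mul_sup, ← pow_succ']
          refine sup_le_sup_right ?_ _
          rw [mul_left_comm, pow_succ' _ n]
          exact Ideal.mul_mono_right (Ideal.mul_mono_left le_sup_right)

section

lemma mem_span_singleton_smul_iff {M : Type*} [AddCommGroup M] [Module R M] {r : R}
    {N : Submodule R M} {z : M} : z ∈ Ideal.span {r} • N ↔ ∃ w ∈ N, r • w = z := by
  rw [Submodule.ideal_span_singleton_smul, Submodule.mem_smul_pointwise_iff_exists]

variable {ι : Type*} [DecidableEq ι] (x : ι → R)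

/-- The elements `x i`, `i ∈ S`, form an `M`-regular sequence in any order (without the requirement
`(x) M ≠ M`). -/
def IsPermutablyRegular (S : Finset ι) (M : Type*) [AddCommGroup M] [Module R M] : Prop :=
  ∀ T ⊆ S, ∀ i ∈ S, i ∉ T → ∀ z : M, x i • z ∈ Ideal.span (x '' T) • (⊤ : Submodule R M) →
    z ∈ Ideal.span (x '' T) • (⊤ : Submodule R M)

variable {x} {S T : Finset ι} {i : ι} {M : Type*} [AddCommGroup M] [Module R M]

omit [DecidableEq ι] in
lemma IsPermutablyRegular.mono (h : IsPermutablyRegular x S M) (hT : T ⊆ S) :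
    IsPermutablyRegular x T M :=
  fun U hU i hi ↦ h U (hU.trans hT) i (hT hi)

lemma span_image_insert (j : ι) (T : Finset ι) :
    Ideal.span (x '' (insert j T : Finset ι)) = Ideal.span {x j} ⊔ Ideal.span (x '' T) := by
  rw [Finset.coe_insert, Set.image_insert_eq, Ideal.span_insert]

lemma smul_top_sup_span_singleton (j : ι) (T : Finset ι) :
    Ideal.span (x '' T) • (⊤ : Submodule R M) ⊔ Ideal.span {x j} • ⊤ =
      Ideal.span (x '' (insert j T : Finset ι)) • ⊤ := by
  rw [span_image_insert, Submodule.sup_smul, sup_comm]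

lemma IsPermutablyRegular.quotient {j : ι} (h : IsPermutablyRegular x S M) (hj : j ∈ S)
    (hT : T ⊆ S) (hjT : j ∉ T) :
    IsPermutablyRegular x T (M ⧸ (Ideal.span {x j} • (⊤ : Submodule R M))) := by
  intro U hU i hi hiU z hz
  obtain ⟨z, rfl⟩ := Submodule.mkQ_surjective _ z
  rw [← map_smul, mkQ_mem_smul_top_iff, smul_top_sup_span_singleton] at hz
  rw [mkQ_mem_smul_top_iff, smul_top_sup_span_singleton]
  refine h _ (Finset.insert_subset hj (hU.trans hT)) i (hT hi) ?_ z hz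
  rw [Finset.mem_insert, not_or]
  exact ⟨fun h ↦ hjT (h ▸ hi), hiU⟩

/-- With `K = (x_j) + (x_T)`, write `x_j z = x_j v + w` where `v ∈ Kⁿ M` and `w ∈ (x_T)ⁿ⁺¹ M`. Then
`x_j (z - v)` lies in `(x_T)ⁿ⁺¹ M`, and `x_j` cancels. -/
lemma mem_pow_of_smul_mem_pow_succ {j : ι}
    (h : ∀ n : ℕ, ∀ z : M, x j • z ∈ Ideal.span (x '' T) ^ n • (⊤ : Submodule R M) →
      z ∈ Ideal.span (x '' T) ^ n • (⊤ : Submodule R M)) (n : ℕ) (z : M)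
    (hz : x j • z ∈ Ideal.span (x '' (insert j T : Finset ι)) ^ (n + 1) • (⊤ : Submodule R M)) :
    z ∈ Ideal.span (x '' (insert j T : Finset ι)) ^ n • (⊤ : Submodule R M) := by
  rw [span_image_insert] at hz ⊢
  have h1 := Submodule.smul_mono_left (N := (⊤ : Submodule R M)) (sup_pow_succ_le _ _ n) hz
  rw [Submodule.sup_smul, Submodule.mul_smul, Submodule.mem_sup] at h1
  obtain ⟨u, hu, w, hw, huw⟩ := h1
  obtain ⟨v, hv, rfl⟩ := mem_span_singleton_smul_iff.mp hu
  have h2 : x j • (z - v) ∈ Ideal.span (x '' T) ^ (n + 1) • (⊤ : Submodule R M) := by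
    rwa [smul_sub, ← huw, add_sub_cancel_left]
  have h3 := h _ _ h2
  have h4 : Ideal.span (x '' T) ^ (n + 1) ≤ (Ideal.span {x j} ⊔ Ideal.span (x '' T)) ^ n :=
    (Ideal.pow_le_pow_right n.le_succ).trans (Ideal.pow_right_mono le_sup_right n)
  rw [← sub_add_cancel z v]
  exact add_mem (Submodule.smul_mono_left h4 h3) hv

/-- A permutably regular element stays regular modulo the powers of the ideal generated by the
other elements. -/
lemma IsPermutablyRegular.mem_pow (hi : i ∉ T) (h : IsPermutablyRegular x (insert i T) M) (n : ℕ)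
    (z : M) (hz : x i • z ∈ Ideal.span (x '' T) ^ n • (⊤ : Submodule R M)) :
    z ∈ Ideal.span (x '' T) ^ n • (⊤ : Submodule R M) := by
  induction T using Finset.induction_on generalizing i n z M with
  | empty =>
    cases n with
    | zero => simp
    | succ n =>
      have h0 := h ∅ (Finset.empty_subset _) i (Finset.mem_insert_self _ _) hi z
      simp only [Finset.coe_empty, Set.image_empty, Ideal.span_empty] at hz h0 ⊢
      rw [pow_succ, Submodule.mul_bot] at hz ⊢
      exact h0 hz
  | insert j T hj ih =>
    have hij : i ≠ j := fun h ↦ hi (h ▸ Finset.mem_insert_self _ _)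
    have hiT : i ∉ T := fun h ↦ hi (Finset.mem_insert_of_mem h)
    have hreg := ih hj (h.mono (Finset.subset_insert _ _))
    induction n generalizing z with
    | zero => simp
    | succ n ihn =>
      have hN := h.quotient (T := insert i T) (j := j) (by simp)
        (Finset.insert_subset_insert _ (Finset.subset_insert _ _)) (by simp [hij.symm, hj])
      -- Modulo `x_j` the claim is known for `T`, so `z = w + x_j t` with `w ∈ (x_T)ⁿ⁺¹ M`. Then
      -- `x_j x_i t` lies in the power `n + 1`; cancelling `x_j` costs one exponent, and the
      -- induction on `n` handles `t`.
      have h1 := ih hiT hN (n + 1) (Submodule.mkQ _ z) (by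
        rw [← map_smul, mkQ_mem_smul_top_iff]
        rw [span_image_insert] at hz
        have := Submodule.smul_mono_left (N := (⊤ : Submodule R M)) (sup_pow_succ_le _ _ n) hz
        rw [Submodule.sup_smul, Submodule.mul_smul, sup_comm] at this
        exact sup_le_sup_left (α := Submodule R M) (smul_mono_right _ le_top) _ this)
      rw [mkQ_mem_smul_top_iff, Submodule.mem_sup] at h1
      obtain ⟨w, hw, v, hv, rfl⟩ := h1
      obtain ⟨t, -, rfl⟩ := mem_span_singleton_smul_iff.mp hv
      have hle : Ideal.span (x '' T) ^ (n + 1) ≤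
          Ideal.span (x '' (insert j T : Finset ι)) ^ (n + 1) := by
        rw [span_image_insert]
        exact Ideal.pow_right_mono le_sup_right _
      have hw' := Submodule.smul_mono_left hle hw
      refine add_mem hw' ?_
      have h2 : x j • x i • t ∈ Ideal.span (x '' (insert j T : Finset ι)) ^ (n + 1) •
          (⊤ : Submodule R M) := by
        rw [smul_comm, ← add_sub_cancel_left (x i • w) (x i • x j • t), ← smul_add]
        exact sub_mem hz (Submodule.smul_mem _ _ hw')
      have h3 := ihn t (mem_pow_of_smul_mem_pow_succ hreg n _ h2)
      rw [pow_succ', Submodule.mul_smul]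
      refine Submodule.smul_mem_smul (Ideal.subset_span ⟨j, by simp, rfl⟩) h3

lemma IsPermutablyRegular.smul_mem_pow_succ_iff {j : ι} (hj : j ∉ T)
    (h : IsPermutablyRegular x (insert j T) M) (n : ℕ) (z : M) :
    x j • z ∈ Ideal.span (x '' (insert j T : Finset ι)) ^ (n + 1) • (⊤ : Submodule R M) ↔
      z ∈ Ideal.span (x '' (insert j T : Finset ι)) ^ n • (⊤ : Submodule R M) := by
  refine ⟨mem_pow_of_smul_mem_pow_succ (h.mem_pow hj) n z, fun hz ↦ ?_⟩
  rw [pow_succ', Submodule.mul_smul]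
  exact Submodule.smul_mem_smul (Ideal.subset_span ⟨j, by simp, rfl⟩) hz

/-- The Hilbert–Samuel function of a regular sequence. -/
lemma IsPermutablyRegular.length_quotient_pow {M : Type u} [AddCommGroup M] [Module R M]
    (h : IsPermutablyRegular x S M) (n : ℕ) :
    Module.length R (M ⧸ (Ideal.span (x '' S) ^ (n + 1) • (⊤ : Submodule R M))) =
      Module.length R (M ⧸ (Ideal.span (x '' S) • (⊤ : Submodule R M))) *
        ((n + S.card).choose S.card : ℕ) := by
  induction S using Finset.induction_on generalizing M n with
  | empty =>
    have h0 : Ideal.span (x '' (∅ : Finset ι)) ^ (n + 1) = Ideal.span (x '' (∅ : Finset ι)) := by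
      simp [pow_succ]
    rw [h0]
    simp
  | insert j T hj ih =>
    induction n with
    | zero =>
      rw [zero_add, pow_one]
      simp
    | succ n ihn =>
      set K := Ideal.span (x '' (insert j T : Finset ι)) with hK
      set P : Submodule R M := Ideal.span {x j} • ⊤ with hP
      have hjK : x j ∈ K := Ideal.subset_span ⟨j, by simp, rfl⟩
      have hPK : Ideal.span (x '' T) • (⊤ : Submodule R M) ⊔ P = K • ⊤ :=
        smul_top_sup_span_singleton j T
      have hN := h.quotient (T := T) (j := j) (by simp) (Finset.subset_insert _ _) hj
      have h1 := ih hN (n + 1)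
      rw [length_quotient_smul_top, length_quotient_smul_top, hPK] at h1
      -- Modulo `x_j`, the ideals `K` and `(x_T)` have the same powers.
      have h2 : Ideal.span (x '' T) ^ (n + 1 + 1) • (⊤ : Submodule R M) ⊔ P =
          K ^ (n + 1 + 1) • ⊤ ⊔ P := by
        apply le_antisymm
        · refine sup_le_sup_right (Submodule.smul_mono_left (Ideal.pow_right_mono ?_ _)) _
          rw [hK, span_image_insert]
          exact le_sup_right
        · refine sup_le ?_ le_sup_right
          rw [hK, span_image_insert]
          refine (Submodule.smul_mono_left (sup_pow_succ_le _ _ _)).trans ?_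
          rw [Submodule.sup_smul, Submodule.mul_smul, sup_comm]
          exact sup_le_sup_left (smul_mono_right _ le_top) _
      rw [h2] at h1
      -- The exact sequence `0 → M/Kⁿ⁺¹ → M/Kⁿ⁺² → M/(Kⁿ⁺² + x_j M) → 0`, with first map
      -- multiplication by `x_j`, turns the formula into Pascal's rule.
      let f : M ⧸ (K ^ (n + 1) • (⊤ : Submodule R M)) →ₗ[R]
          M ⧸ (K ^ (n + 1 + 1) • (⊤ : Submodule R M)) :=
        Submodule.mapQ _ _ (LinearMap.lsmul R M (x j))
          fun z hz ↦ (h.smul_mem_pow_succ_iff hj (n + 1) z).mpr hz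
      let g : M ⧸ (K ^ (n + 1 + 1) • (⊤ : Submodule R M)) →ₗ[R]
        M ⧸ (K ^ (n + 1 + 1) • (⊤ : Submodule R M) ⊔ P) := Submodule.factor le_sup_left
      have hf : Function.Injective f := by
        refine (injective_iff_map_eq_zero _).mpr fun z hz ↦ ?_
        obtain ⟨z, rfl⟩ := Submodule.mkQ_surjective _ z
        exact (Submodule.Quotient.mk_eq_zero _).mpr
          ((h.smul_mem_pow_succ_iff hj (n + 1) z).mp ((Submodule.Quotient.mk_eq_zero _).mp hz))
      have hfg : Function.Exact f g := by
        intro z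
        obtain ⟨z, rfl⟩ := Submodule.mkQ_surjective _ z
        have h3 : g (Submodule.mkQ _ z) = 0 ↔ z ∈ K ^ (n + 1 + 1) • (⊤ : Submodule R M) ⊔ P :=
          Submodule.Quotient.mk_eq_zero _
        rw [h3, Submodule.mem_sup]
        constructor
        · rintro ⟨w, hw, v, hv, rfl⟩
          obtain ⟨t, -, rfl⟩ := mem_span_singleton_smul_iff.mp hv
          refine ⟨Submodule.mkQ _ t, ?_⟩
          exact (Submodule.Quotient.eq _).mpr (by simpa using hw)
        · rintro ⟨t, ht⟩
          obtain ⟨t, rfl⟩ := Submodule.mkQ_surjective _ t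
          refine ⟨z - x j • t, (Submodule.Quotient.eq _).mp ht.symm, x j • t, ?_, by simp⟩
          exact mem_span_singleton_smul_iff.mpr ⟨t, trivial, rfl⟩
      rw [Module.length_eq_add_of_exact f g hf (Submodule.factor_surjective _) hfg, ihn, h1,
        ← mul_add, Finset.card_insert_of_notMem hj]
      congr 1
      norm_cast
      rw [show n + 1 + (T.card + 1) = (n + 1 + T.card) + 1 by lia, Nat.choose_succ_succ,
        show n + (T.card + 1) = n + 1 + T.card by lia, add_comm]

end

end

/-! ### Duality for modules with simple socle. -/

section Socle

variable (A : Type*) [CommRing A] [IsLocalRing A]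

/-- Any nonzero socle element generates the socle. -/
def HasSimpleSocle (H : Type*) [AddCommGroup H] [Module A H] : Prop :=
  ∀ z w : H, (∀ r ∈ IsLocalRing.maximalIdeal A, r • z = 0) →
    (∀ r ∈ IsLocalRing.maximalIdeal A, r • w = 0) → z ≠ 0 → ∃ r : A, w = r • z

variable {A} {H : Type*} [AddCommGroup H] [Module A H]

omit [IsLocalRing A] in
lemma length_le_one_of_forall_exists_smul (h : ∀ f g : H, f ≠ 0 → ∃ r : A, r • f = g) :
    Module.length A H ≤ 1 := by
  rcases subsingleton_or_nontrivial H with _ | _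
  · simp [Module.length_eq_zero]
  · have : IsSimpleModule A H :=
      isSimpleModule_iff_toSpanSingleton_surjective.mpr ⟨inferInstance, fun f hf g ↦ h f g hf⟩
    rw [Module.length_eq_one]

/-- A map out of the residue field is determined by the image of `1`, which is a socle element. -/
lemma HasSimpleSocle.length_hom_simple_le (hH : HasSimpleSocle A H) {N : Type*} [AddCommGroup N]
    [Module A N] [IsSimpleModule A N] : Module.length A (N →ₗ[A] H) ≤ 1 := by
  obtain ⟨I, hI, ⟨e⟩⟩ := isSimpleModule_iff_quot_maximal.mp ‹IsSimpleModule A N›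
  obtain rfl := IsLocalRing.eq_maximalIdeal hI
  have hkill (f : N →ₗ[A] H) : ∀ r ∈ IsLocalRing.maximalIdeal A, r • f (e.symm 1) = 0 := by
    intro r hr
    rw [← map_smul, ← map_smul, Algebra.smul_def, mul_one, Ideal.Quotient.algebraMap_eq,
      Ideal.Quotient.eq_zero_iff_mem.mpr hr, map_zero, map_zero]
  have hext {f g : N →ₗ[A] H} (h : f (e.symm 1) = g (e.symm 1)) : f = g := by
    ext x
    obtain ⟨r, hr⟩ := Ideal.Quotient.mk_surjective (e x)
    have : x = r • e.symm 1 := by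
      rw [← map_smul, Algebra.smul_def, mul_one, Ideal.Quotient.algebraMap_eq, hr,
        LinearEquiv.symm_apply_apply]
    rw [this, map_smul, map_smul, h]
  refine length_le_one_of_forall_exists_smul fun f g hf ↦ ?_
  obtain ⟨r, hr⟩ := hH _ _ (hkill f) (hkill g) fun h ↦ hf (hext h)
  exact ⟨r, hext hr.symm⟩

omit [IsLocalRing A] in
-- Left exactness of `Hom(-, H)`; taking the range of restriction as the last term makes the
-- sequence short exact.
lemma length_hom_eq_add {N : Type*} [AddCommGroup N] [Module A N] (K : Submodule A N) :
    Module.length A (N →ₗ[A] H) = Module.length A (N ⧸ K →ₗ[A] H) +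
      Module.length A (LinearMap.range (LinearMap.lcomp A H K.subtype)) := by
  refine Module.length_eq_add_of_exact (LinearMap.lcomp A H K.mkQ)
    (LinearMap.lcomp A H K.subtype).rangeRestrict ?_ (LinearMap.surjective_rangeRestrict _) ?_
  · intro f g h
    apply Submodule.linearMap_qext
    exact h
  · intro f
    constructor
    · intro h
      have h' : f ∘ₗ K.subtype = 0 := congrArg Subtype.val h
      have hle : K ≤ LinearMap.ker f := fun x hx ↦ LinearMap.congr_fun h' ⟨x, hx⟩
      exact ⟨K.liftQ f hle, K.liftQ_mkQ f hle⟩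
    · rintro ⟨g, rfl⟩
      apply Subtype.ext
      ext x
      change g (K.mkQ x) = 0
      rw [Submodule.mkQ_apply, (Submodule.Quotient.mk_eq_zero K).mpr x.2, map_zero]

/-- `ℓ(Hom(N, H)) ≤ ℓ(N)` when the socle of `H` is simple. -/
lemma HasSimpleSocle.length_hom_le (hH : HasSimpleSocle A H) {N : Type*} [AddCommGroup N]
    [Module A N] (hN : IsFiniteLength A N) :
    Module.length A (N →ₗ[A] H) ≤ Module.length A N := by
  induction hN with
  | of_subsingleton => simp [Module.length_eq_zero]
  | @of_simple_quotient N _ _ K _ _ ih =>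
    rw [length_hom_eq_add K, Module.length_eq_add_of_exact K.subtype K.mkQ K.injective_subtype
      K.mkQ_surjective (LinearMap.exact_subtype_mkQ K), add_comm]
    refine add_le_add ((Module.length_le_of_injective _ (Submodule.injective_subtype _)).trans ih) ?_
    rw [Module.length_eq_one A (N ⧸ K)]
    exact hH.length_hom_simple_le

/-- A module of finite length with simple socle has the length of `A` modulo its annihilator. -/
lemma HasSimpleSocle.length_eq (hH : HasSimpleSocle A H) (hfin : IsFiniteLength A H) :
    Module.length A H = Module.length A (A ⧸ Module.annihilator A H) := by
  have hker : LinearMap.ker (LinearMap.lsmul A H) = Module.annihilator A H := by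
    ext r
    rw [LinearMap.mem_ker, ← Module.mem_annihilator_iff_lsmul_eq_zero]
  let φ : (A ⧸ Module.annihilator A H) →ₗ[A] (H →ₗ[A] H) :=
    (Module.annihilator A H).liftQ (LinearMap.lsmul A H) hker.ge
  have hφ : Function.Injective φ :=
    LinearMap.ker_eq_bot.mp (Submodule.ker_liftQ_eq_bot _ _ _ hker.le)
  have h1 : Module.length A (A ⧸ Module.annihilator A H) ≤ Module.length A H :=
    (Module.length_le_of_injective φ hφ).trans (hH.length_hom_le hfin)
  have hfin' : IsFiniteLength A (A ⧸ Module.annihilator A H) := by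
    rw [← Module.length_ne_top_iff] at hfin ⊢
    exact ne_top_of_le_ne_top hfin h1
  -- The action embeds `A/ann H` in `Hom(H, H)`, giving one inequality. Its transpose embeds `H` in
  -- `Hom(A/ann H, H)`, since evaluation at `1` recovers the element, giving the other.
  refine le_antisymm ((Module.length_le_of_injective φ.flip fun x y h ↦ ?_).trans
    (hH.length_hom_le hfin')) h1
  have h2 (x : H) : φ.flip x (Submodule.Quotient.mk 1) = x := one_smul A x
  rw [← h2 x, h, h2]

/-- An Artinian local ring with simple socle is self-injective. -/
lemma baer_self_of_hasSimpleSocle [IsArtinianRing A] (hA : HasSimpleSocle A A) :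
    Module.Baer A A := by
  intro I f
  have hfin {N : Type _} [AddCommGroup N] [Module A N] [Module.Finite A N] : IsFiniteLength A N :=
    isFiniteLength_iff_isNoetherian_isArtinian.mpr ⟨inferInstance, inferInstance⟩
  have h1 := length_hom_eq_add (A := A) (H := A) I
  have h2 := Module.length_eq_add_of_exact (R := A) I.subtype I.mkQ I.injective_subtype
      I.mkQ_surjective (LinearMap.exact_subtype_mkQ I)
  have h3 := hA.length_hom_le (N := A ⧸ I) hfin
  have h4 := hA.length_hom_le (N := I) hfin
  rw [(LinearMap.ringLmapEquivSelf A A A).length_eq, h2] at h1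
  have hI : Module.length A I ≠ ⊤ := Module.length_ne_top_iff.mpr hfin
  have hQ : Module.length A (A ⧸ I) ≠ ⊤ := Module.length_ne_top_iff.mpr hfin
  have h5 : IsFiniteLength A (I →ₗ[A] A) :=
    Module.length_ne_top_iff.mp (ne_top_of_le_ne_top hI h4)
  obtain ⟨_, _⟩ := isFiniteLength_iff_isNoetherian_isArtinian.mp h5
  -- Since `ℓ(A) = ℓ(Hom(A/I, A)) + ℓ(range)` and `ℓ(Hom(A/I, A)) ≤ ℓ(A/I)`, the range of
  -- restriction has length at least `ℓ(I) ≥ ℓ(Hom(I, A))` and cannot be proper.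
  have htop : LinearMap.range (LinearMap.lcomp A A I.subtype) = ⊤ := by
    by_contra hne
    have h6 := (Submodule.length_lt hne).trans_le h4
    have h7 : Module.length A I + Module.length A (A ⧸ I) <
        Module.length A I + Module.length A (A ⧸ I) := by
      conv_lhs => rw [h1]
      calc _ ≤ Module.length A (A ⧸ I) + _ := add_le_add_left h3 _
        _ < Module.length A (A ⧸ I) + Module.length A I := (ENat.add_lt_add_iff_left hQ).mpr h6
        _ = _ := add_comm _ _
    exact h7.ne rfl
  obtain ⟨g, hg⟩ : f ∈ LinearMap.range (LinearMap.lcomp A A I.subtype) := htop ▸ Submodule.mem_top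
  exact ⟨g, fun x hx ↦ LinearMap.congr_fun hg ⟨x, hx⟩⟩

end Socle

/-! ### From self-injectivity modulo a regular element to finite injective dimension. -/

section Gorenstein

variable {B : Type u} [CommRing B]

/-- If `B ⧸ b B` is self-injective, maps from `K ⊆ F` to `B ⧸ b B` extend to `F` when `F ⧸ K` has
no `b`-torsion. -/
lemma exists_extension_mod {b : B} (hbaer : Module.Baer (B ⧸ Ideal.span {b}) (B ⧸ Ideal.span {b}))
    {F : Type u} [AddCommGroup F] [Module B F] {K : Submodule B F}
    (hK : ∀ z, b • z ∈ K → z ∈ K) (f : K →ₗ[B] B) :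
    ∃ g : F →ₗ[B] B ⧸ Ideal.span {b}, ∀ x : K, g x = Ideal.Quotient.mk _ (f x) := by
  let I := Ideal.span {b}
  have hsurj : Function.Surjective (algebraMap B (B ⧸ I)) := Ideal.Quotient.mk_surjective
  let i₀ : (K ⧸ (I • ⊤ : Submodule B K)) →ₗ[B] (F ⧸ (I • ⊤ : Submodule B F)) :=
    Submodule.mapQ _ _ K.subtype (by
      rw [← Submodule.map_le_iff_le_comap, Submodule.map_smul'']
      exact smul_mono_right _ le_top)
  -- Absence of `b`-torsion in `F ⧸ K` says `K ∩ bF = bK`.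
  have hi₀ : Function.Injective i₀ := by
    refine (injective_iff_map_eq_zero _).mpr fun z hz ↦ ?_
    obtain ⟨z, rfl⟩ := Submodule.mkQ_surjective _ z
    have hz' : (z : F) ∈ I • (⊤ : Submodule B F) := (Submodule.Quotient.mk_eq_zero _).mp hz
    obtain ⟨w, -, hw⟩ := mem_span_singleton_smul_iff.mp hz'
    refine (Submodule.Quotient.mk_eq_zero _).mpr (mem_span_singleton_smul_iff.mpr
      ⟨⟨w, hK w (hw ▸ z.2)⟩, trivial, Subtype.ext hw⟩)
  let f₀ : (K ⧸ (I • ⊤ : Submodule B K)) →ₗ[B] B ⧸ I :=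
    Submodule.liftQ _ (I.mkQ ∘ₗ f) fun z hz ↦ by
      obtain ⟨w, -, rfl⟩ := mem_span_singleton_smul_iff.mp hz
      rw [LinearMap.mem_ker, map_smul, LinearMap.comp_apply, ← map_smul]
      exact (Submodule.Quotient.mk_eq_zero _).mpr
        (Ideal.mul_mem_right _ _ (Ideal.mem_span_singleton_self b))
  obtain ⟨h, hh⟩ := (Module.Baer.injective hbaer).out (i₀.extendScalarsOfSurjective hsurj) hi₀
    (f₀.extendScalarsOfSurjective hsurj)
  exact ⟨h.restrictScalars B ∘ₗ Submodule.mkQ _, fun x ↦ hh (Submodule.Quotient.mk x)⟩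

variable [IsLocalRing B] [IsNoetherianRing B] {b : B}

/-- If `b` is regular and `B ⧸ b B` is self-injective, maps `K → B` extend to `F` when `F ⧸ K` has
no `b`-torsion, `F` finite projective. -/
lemma exists_extension (hb : b ∈ IsLocalRing.maximalIdeal B) (hreg : ∀ z, b * z = 0 → z = 0)
    (hbaer : Module.Baer (B ⧸ Ideal.span {b}) (B ⧸ Ideal.span {b}))
    {F : Type u} [AddCommGroup F] [Module B F] [Module.Finite B F] [Module.Projective B F]
    {K : Submodule B F} (hK : ∀ z, b • z ∈ K → z ∈ K) (f : K →ₗ[B] B) :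
    ∃ g : F →ₗ[B] B, g ∘ₗ K.subtype = f := by
  suffices h : (⊤ : Submodule B (K →ₗ[B] B)) ≤ LinearMap.range (LinearMap.lcomp B B K.subtype) by
    exact h (Submodule.mem_top (x := f))
  -- Nakayama on `Hom(K, B)`: every `f` agrees modulo `b` with the restriction of a map on `F`, so
  -- it differs from a restriction by `b` times another map `K → B`.
  refine Submodule.le_of_le_smul_of_le_jacobson_bot (I := Ideal.span {b}) Module.Finite.fg_top
    ?_ fun f _ ↦ ?_
  · rw [IsLocalRing.jacobson_eq_maximalIdeal ⊥ bot_ne_top, Ideal.span_singleton_le_iff_mem]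
    exact hb
  · obtain ⟨g, hg⟩ := exists_extension_mod hbaer hK f
    obtain ⟨g', rfl⟩ := Module.projective_lifting_property (Submodule.mkQ _) g
      (Submodule.mkQ_surjective _)
    have hmem (x : K) : f x - g' x ∈ LinearMap.range (LinearMap.lsmul B B b) := by
      have h1 : f x - g' x ∈ Ideal.span {b} := Ideal.Quotient.eq.mp (hg x).symm
      obtain ⟨y, hy⟩ := Ideal.mem_span_singleton'.mp h1
      exact ⟨y, by rw [← hy, mul_comm]; rfl⟩
    have hinj : Function.Injective (LinearMap.lsmul B B b) :=
      (injective_iff_map_eq_zero _).mpr hreg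
    let e := LinearEquiv.ofInjective _ hinj
    let k : K →ₗ[B] B := e.symm.toLinearMap ∘ₗ
      (f - g' ∘ₗ K.subtype).codRestrict (LinearMap.range (LinearMap.lsmul B B b)) hmem
    have hk : f = g' ∘ₗ K.subtype + b • k := by
      ext x
      have h1 : b • k x = f x - g' x := congrArg Subtype.val (e.apply_symm_apply ⟨_, hmem x⟩)
      rw [LinearMap.add_apply, LinearMap.smul_apply, h1]
      simp
    rw [hk]
    exact Submodule.add_mem_sup ⟨g', rfl⟩
      (Submodule.smul_mem_smul (Ideal.mem_span_singleton_self b) trivial)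

/-- A Noetherian local ring with a regular element `b` such that `B ⧸ b B` is self-injective is
Gorenstein. -/
lemma hasInjectiveDimensionLE_one (hb : b ∈ IsLocalRing.maximalIdeal B)
    (hreg : ∀ z, b * z = 0 → z = 0)
    (hbaer : Module.Baer (B ⧸ Ideal.span {b}) (B ⧸ Ideal.span {b})) :
    HasInjectiveDimensionLE (ModuleCat.of B B) 1 := by
  let E : ModuleCat.{u} B := Injective.under (ModuleCat.of B B)
  let i : B →ₗ[B] E := (Injective.ι (ModuleCat.of B B)).hom
  have hi : Function.Injective i := (ModuleCat.mono_iff_injective _).mp inferInstance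
  have hEi : Injective E := Injective.injective_under (ModuleCat.of B B)
  have hE : Module.Baer B E := Module.Baer.of_injective
    ((Module.injective_iff_injective_object B E).mpr hEi)
  let π := (LinearMap.range i).mkQ
  -- Given `φ : I → E/B`, present `I` by `p : Bⁿ → I` and lift `φ ∘ p` to `ψ : Bⁿ → E`. On `ker p`
  -- the values of `ψ` lie in `B`, and `Bⁿ/ker p ≅ I` has no `b`-torsion, so this restriction
  -- extends to `g : Bⁿ → B`. Then `ψ - g` descends to a lift `I → E` of `φ`, which extends to `B`
  -- because `E` is injective.
  have hC : Module.Baer B (E ⧸ LinearMap.range i) := by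
    intro I φ
    obtain ⟨n, p, hp⟩ := Module.Finite.exists_fin' B I
    obtain ⟨ψ, hψ⟩ := Module.projective_lifting_property π (φ ∘ₗ p) (Submodule.mkQ_surjective _)
    have hK (z) (hz : b • z ∈ LinearMap.ker p) : z ∈ LinearMap.ker p := by
      rw [LinearMap.mem_ker, map_smul] at hz
      exact Subtype.ext (hreg _ (congrArg Subtype.val hz))
    let e := LinearEquiv.ofInjective i hi
    have hmem (z : LinearMap.ker p) : ψ z ∈ LinearMap.range i := by
      have h1 : π (ψ z) = 0 := by
        have := LinearMap.congr_fun hψ z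
        rw [LinearMap.comp_apply, LinearMap.comp_apply, LinearMap.mem_ker.mp z.2, map_zero] at this
        exact this
      exact (Submodule.Quotient.mk_eq_zero _).mp h1
    obtain ⟨g, hg⟩ := exists_extension hb hreg hbaer hK
      (e.symm.toLinearMap ∘ₗ (ψ ∘ₗ (LinearMap.ker p).subtype).codRestrict _ hmem)
    have hig (z : LinearMap.ker p) : i (g z) = ψ z := by
      have h1 : g z = e.symm ⟨ψ z, hmem z⟩ := LinearMap.congr_fun hg z
      rw [h1]
      exact congrArg Subtype.val (e.apply_symm_apply ⟨ψ z, hmem z⟩)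
    let θ : ((Fin n → B) ⧸ LinearMap.ker p) →ₗ[B] E :=
      (LinearMap.ker p).liftQ (ψ - i ∘ₗ g) fun z hz ↦ by
        rw [LinearMap.mem_ker, LinearMap.sub_apply, LinearMap.comp_apply, hig ⟨z, hz⟩, sub_self]
    let ε := p.quotKerEquivOfSurjective hp
    obtain ⟨χ, hχ⟩ := hE I (θ ∘ₗ ε.symm.toLinearMap)
    refine ⟨π ∘ₗ χ, fun x hx ↦ ?_⟩
    obtain ⟨z, hz⟩ := hp ⟨x, hx⟩
    have h1 : ε.symm ⟨x, hx⟩ = Submodule.Quotient.mk z := by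
      rw [LinearEquiv.symm_apply_eq, ← hz]
      rfl
    have h2 : π (i (g z)) = 0 := (Submodule.Quotient.mk_eq_zero _).mpr ⟨_, rfl⟩
    have h3 : π (ψ z) = φ (p z) := LinearMap.congr_fun hψ z
    rw [LinearMap.comp_apply, hχ x hx, LinearMap.comp_apply, LinearEquiv.coe_coe, h1]
    change π (ψ z - i (g z)) = _
    rw [map_sub, h2, h3, sub_zero, hz]
  have hCi : Injective (ModuleCat.of B (E ⧸ LinearMap.range i)) :=
    (Module.injective_iff_injective_object B _).mp (Module.Baer.injective hC)
  have hS := shortExact_of_exact hi (Submodule.mkQ_surjective (LinearMap.range i))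
    (LinearMap.exact_map_mkQ_range i)
  have h2 : HasInjectiveDimensionLT (ModuleCat.of B E) 1 :=
    injective_iff_hasInjectiveDimensionLT_one.mp hEi
  exact hS.hasInjectiveDimensionLT_X₁ 1 (injective_iff_hasInjectiveDimensionLT_one.mp hCi)
    (hasInjectiveDimensionLT_of_ge _ 1 2 one_le_two)

end Gorenstein

/-! ### Finite length, `d`-sequences, length comparisons and a limit. -/

section

open IsLocalRing

section FiniteLength

variable {A : Type*} [CommRing A] [IsLocalRing A] [IsNoetherianRing A]

omit [IsNoetherianRing A] in
lemma maximalIdeal_le_map_of_surjective {B : Type*} [CommRing B] [IsLocalRing B] (f : A →+* B)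
    (hf : Function.Surjective f) : maximalIdeal B ≤ (maximalIdeal A).map f := by
  intro y hy
  obtain ⟨x, rfl⟩ := hf y
  exact Ideal.mem_map_of_mem f fun h ↦ hy (h.map f)

lemma isArtinianRing_of_pow_maximalIdeal_le {B : Type*} [CommRing B] [Nontrivial B] (f : A →+* B)
    (hf : Function.Surjective f) {k : ℕ} (hk : ∀ r ∈ maximalIdeal A ^ k, f r = 0) :
    IsArtinianRing B := by
  have hB : IsLocalRing B := IsLocalRing.of_surjective' f hf
  have : IsNoetherianRing B := isNoetherianRing_of_surjective A B f hf
  rw [isArtinianRing_iff_isNilpotent_maximalIdeal]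
  refine ⟨k, ?_⟩
  rw [Ideal.zero_eq_bot, eq_bot_iff]
  refine (Ideal.pow_right_mono (maximalIdeal_le_map_of_surjective f hf) k).trans ?_
  rw [← Ideal.map_pow, Ideal.map_le_iff_le_comap]
  exact fun r hr ↦ hk r hr

lemma isFiniteLength_of_pow_smul_eq_zero {M : Type*} [AddCommGroup M] [Module A M]
    [Module.Finite A M] {k : ℕ} (hk : ∀ r ∈ maximalIdeal A ^ k, ∀ x : M, r • x = 0) :
    IsFiniteLength A M := by
  rcases subsingleton_or_nontrivial (A ⧸ maximalIdeal A ^ k) with h | h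
  · have h1 : (1 : A) ∈ maximalIdeal A ^ k := by
      rw [← Ideal.Quotient.eq_zero_iff_mem]
      exact Subsingleton.elim _ _
    have : Subsingleton M := subsingleton_of_forall_eq 0 fun x ↦ by rw [← one_smul A x, hk 1 h1]
    exact .of_subsingleton
  · have hart : IsArtinianRing (A ⧸ maximalIdeal A ^ k) :=
      isArtinianRing_of_pow_maximalIdeal_le (Ideal.Quotient.mk _) Ideal.Quotient.mk_surjective
        fun r hr ↦ Ideal.Quotient.eq_zero_iff_mem.mpr hr
    have htors : Module.IsTorsionBySet A M (maximalIdeal A ^ k : Ideal A) := fun x r ↦ hk r r.2 x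
    let _ := htors.module
    have : IsScalarTower A (A ⧸ maximalIdeal A ^ k) M := htors.isScalarTower
    have : Module.Finite (A ⧸ maximalIdeal A ^ k) M := Module.Finite.of_restrictScalars_finite A _ _
    have : IsArtinian A M := isArtinian_of_surjective_algebraMap (R := A ⧸ maximalIdeal A ^ k)
      Ideal.Quotient.mk_surjective
    exact isFiniteLength_iff_isNoetherian_isArtinian.mpr ⟨inferInstance, inferInstance⟩

end FiniteLength

section DSequence

/-- This frees the `d`-sequence condition from any ordering. A bijection of the first `|T|` indices
with `T` extends to a permutation; a swap then puts `i` in position `|T|` without touching earlier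
positions. -/
lemma exists_perm_image_eq {d : ℕ} (T : Finset (Fin d)) {i : Fin d} (hi : i ∉ T) :
    ∃ (σ : Equiv.Perm (Fin d)) (t : Fin d), σ t = i ∧ σ '' {k | k < t} = T := by
  have hcard : T.card < d := by
    have := Finset.card_lt_univ_of_notMem hi
    simpa using this
  have e : {k : Fin d // k.val < T.card} ≃ {k // k ∈ T} := by
    apply Fintype.equivOfCardEq
    rw [Fintype.card_coe, Fintype.card_subtype, Fin.card_filter_val_lt, min_eq_right hcard.le]
  let τ := e.extendSubtype
  have hτ : ∀ k : Fin d, τ k ∈ T ↔ k.val < T.card := by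
    intro k
    constructor
    · intro h
      by_contra hk
      exact e.extendSubtype_not_mem k hk h
    · exact e.extendSubtype_mem k
  let t : Fin d := ⟨T.card, hcard⟩
  have hti : t ≤ τ.symm i := by
    by_contra h
    exact hi (by simpa using (hτ (τ.symm i)).mpr (by simpa [t, Fin.lt_def] using h))
  have hsw (k : Fin d) (hk : k < t) : Equiv.swap t (τ.symm i) k = k :=
    Equiv.swap_apply_of_ne_of_ne hk.ne (hk.trans_le hti).ne
  refine ⟨τ * Equiv.swap t (τ.symm i), t, by simp, ?_⟩
  ext j
  constructor
  · rintro ⟨k, hk, rfl⟩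
    rw [Equiv.Perm.mul_apply, hsw k hk]
    exact (hτ k).mpr hk
  · intro hj
    have hk : τ.symm j < t := (hτ _).mp (by simpa using hj)
    exact ⟨τ.symm j, hk, by rw [Equiv.Perm.mul_apply, hsw _ hk, Equiv.apply_symm_apply]⟩

variable {A : Type*} [CommRing A] [IsLocalRing A] {d : ℕ} {a : Fin d → A}

/-- The defining property of a standard system of parameters, for an unordered set of members. -/
lemma IsStandardSystemOfParameters.mem_of_mul_mem (ha : IsStandardSystemOfParameters a)
    (n : Fin d → ℕ) (hn : ∀ i, 1 ≤ n i) {T : Finset (Fin d)} {i j : Fin d} (hi : i ∉ T)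
    (hj : j ∉ T) {z : A}
    (hz : z * (a i ^ n i * a j ^ n j) ∈ Ideal.span ((fun k ↦ a k ^ n k) '' T)) :
    z * a j ^ n j ∈ Ideal.span ((fun k ↦ a k ^ n k) '' T) := by
  obtain ⟨σ, t, rfl, hσ⟩ := exists_perm_image_eq T hi
  have him : (fun i => a (σ i) ^ n (σ i)) '' {k | k < t} = (fun k ↦ a k ^ n k) '' T := by
    rw [← hσ, Set.image_image]
  have hle : t ≤ σ.symm j := by
    by_contra h
    have : j ∈ (T : Set (Fin d)) := hσ ▸ ⟨σ.symm j, not_le.mp h, by simp⟩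
    exact hj this
  have h := ha.2 n hn σ t (σ.symm j) hle
  rw [him] at h
  have h1 : z ∈ (Ideal.span ((fun k ↦ a k ^ n k) '' T)).colon {a (σ (σ.symm j)) ^ n (σ (σ.symm j))} := by
    rw [← h, Submodule.mem_colon_singleton, smul_eq_mul]
    simpa using hz
  rw [Submodule.mem_colon_singleton, smul_eq_mul] at h1
  simpa using h1

/-- Multiply by `a j`, then cancel `a i` from `a i * a j` by the `d`-sequence property. -/
lemma IsStandardSystemOfParameters.mul_mem_of_mul_mem (ha : IsStandardSystemOfParameters a)
    {T : Finset (Fin d)} {i j : Fin d} (hi : i ∉ T) (hj : j ∉ T) {z : A}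
    (hz : a i * z ∈ Ideal.span (a '' T)) : a j * z ∈ Ideal.span (a '' T) := by
  have := ha.mem_of_mul_mem (fun _ ↦ 1) (fun _ ↦ le_rfl) (T := T) hi hj (z := z) (by
    simp only [pow_one]
    rw [show z * (a i * a j) = a j * (a i * z) by ring]
    exact Ideal.mul_mem_left _ _ hz)
  simpa [mul_comm] using this

/-- `(a_jᴺ) : a_iᵖ = (a_jᴺ) : a_i`. -/
lemma IsStandardSystemOfParameters.mul_mem_of_pow_mul_mem (ha : IsStandardSystemOfParameters a)
    {i j : Fin d} (hij : i ≠ j) {N : ℕ} (hN : 1 ≤ N) (p : ℕ) {z : A}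
    (hz : a i ^ p * z ∈ Ideal.span {a j ^ N}) : a i * z ∈ Ideal.span {a j ^ N} := by
  induction p with
  | zero => exact Ideal.mul_mem_left _ _ (by simpa using hz)
  | succ p ih =>
    rcases p with _ | p
    · simpa using hz
    · refine ih ?_
      -- Exponent `N` at `j` and `1` elsewhere; with both indices equal to `i`, the property removes
      -- one factor `a i` from a product containing two.
      have h := ha.mem_of_mul_mem (Function.update (fun _ ↦ 1) j N) (fun k ↦ by
        rcases eq_or_ne k j with rfl | hk
        · simpa
        · simp [hk]) (T := {j}) (i := i) (j := i) (by simpa) (by simpa) (z := a i ^ p * z)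
      simp only [Finset.coe_singleton, Set.image_singleton, Function.update_self,
        Function.update_of_ne hij, pow_one] at h
      rw [pow_succ, mul_right_comm]
      refine h ?_
      convert hz using 1
      ring

end DSequence

section Length

variable {A : Type*} [CommRing A] {P M : Type*} [AddCommGroup P] [Module A P] [AddCommGroup M]
  [Module A M]

lemma length_quotient_le_of_comap_le (φ : P →ₗ[A] M) {X : Submodule A M} {Y : Submodule A P}
    (h : X.comap φ ≤ Y) : Module.length A (P ⧸ Y) ≤ Module.length A (M ⧸ X) := by
  refine (Module.length_le_of_surjective _ (Submodule.factor_surjective h)).trans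
    (Module.length_le_of_injective ((X.comap φ).mapQ X φ le_rfl) ?_)
  refine LinearMap.ker_eq_bot.mp ?_
  rw [Submodule.ker_mapQ, Submodule.mkQ_map_self]

lemma length_quotient_le_add (φ : P →ₗ[A] M) {X : Submodule A M} {Y : Submodule A P}
    (h : Y ≤ X.comap φ) : Module.length A (M ⧸ X) ≤
      Module.length A (P ⧸ Y) + Module.length A (M ⧸ LinearMap.range φ) := by
  let g := Y.mapQ X φ h
  rw [Module.length_eq_add_of_exact (LinearMap.range g).subtype (LinearMap.range g).mkQ
    (Submodule.injective_subtype _) (Submodule.mkQ_surjective _) (LinearMap.exact_subtype_mkQ _)]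
  refine add_le_add (Module.length_le_of_surjective g.rangeRestrict
    g.surjective_rangeRestrict) ?_
  refine Module.length_le_of_surjective ((LinearMap.range φ).mapQ (LinearMap.range g) X.mkQ ?_) ?_
  · rintro _ ⟨x, rfl⟩
    exact ⟨Submodule.Quotient.mk x, rfl⟩
  · intro z
    obtain ⟨z, rfl⟩ := Submodule.mkQ_surjective _ z
    obtain ⟨z, rfl⟩ := Submodule.mkQ_surjective _ z
    exact ⟨Submodule.Quotient.mk z, rfl⟩

lemma length_quotient_add {X Y : Submodule A M} (h : X ≤ Y) :
    Module.length A (M ⧸ X) = Module.length A (Y ⧸ X.comap Y.subtype) +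
      Module.length A (M ⧸ Y) := by
  refine Module.length_eq_add_of_exact ((X.comap Y.subtype).mapQ X Y.subtype le_rfl)
    (Submodule.factor h) ?_ (Submodule.factor_surjective h) ?_
  · refine LinearMap.ker_eq_bot.mp ?_
    rw [Submodule.ker_mapQ, Submodule.mkQ_map_self]
  · intro z
    obtain ⟨z, rfl⟩ := Submodule.mkQ_surjective _ z
    have h1 : Submodule.factor h (X.mkQ z) = 0 ↔ z ∈ Y := Submodule.Quotient.mk_eq_zero _
    rw [h1]
    constructor
    · exact fun hz ↦ ⟨Submodule.Quotient.mk ⟨z, hz⟩, rfl⟩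
    · rintro ⟨w, hw⟩
      obtain ⟨w, rfl⟩ := Submodule.mkQ_surjective _ w
      have h2 : (w : M) - z ∈ X := (Submodule.Quotient.eq X).mp hw
      simpa using sub_mem w.2 (h h2)

lemma eq_of_length_quotient_eq {X Y : Submodule A M} (h : X ≤ Y)
    (heq : Module.length A (M ⧸ X) = Module.length A (M ⧸ Y))
    (hfin : Module.length A (M ⧸ X) ≠ ⊤) : X = Y := by
  have h1 := length_quotient_add h
  rw [heq] at hfin
  have h2 : Module.length A (Y ⧸ X.comap Y.subtype) = 0 := by
    rw [heq] at h1
    generalize Module.length A (Y ⧸ X.comap Y.subtype) = s at h1 ⊢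
    generalize Module.length A (M ⧸ Y) = t at h1 hfin
    lift t to ℕ using hfin
    induction s using ENat.recTopCoe with
    | top => simp at h1
    | coe s => norm_cast at h1 ⊢; lia
  rw [Module.length_eq_zero_iff] at h2
  refine le_antisymm h fun y hy ↦ ?_
  have : (⟨y, hy⟩ : Y) ∈ X.comap Y.subtype :=
    (Submodule.Quotient.mk_eq_zero _).mp (Subsingleton.elim _ _)
  exact this

end Length

section Limit

open Filter Topology

lemma tendsto_add_natCast_div_pow (c : ℝ) (d : ℕ) :
    Tendsto (fun n : ℕ ↦ ((n + c) / n) ^ d) atTop (𝓝 1) := by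
  have h1 : Tendsto (fun n : ℕ ↦ 1 + c / n) atTop (𝓝 1) := by
    simpa using (tendsto_const_div_atTop_nhds_zero_nat c).const_add 1
  have h2 : Tendsto (fun n : ℕ ↦ (1 + c / n) ^ d) atTop (𝓝 1) := by simpa using h1.pow d
  refine h2.congr' ?_
  filter_upwards [eventually_gt_atTop 0] with n hn
  have : (n : ℝ) ≠ 0 := by positivity
  congr 1
  field_simp

/-- A function squeezed between shifts of `E * (n + d).choose d` has normalized leading
coefficient `E`. -/
lemma tendsto_of_le_choose {L : ℕ → ℕ} {E H k d : ℕ} (hd : 1 ≤ d)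
    (hup : ∀ n, L n ≤ E * (n + d).choose d)
    (hlow : ∀ n, E * (n + d).choose d ≤ L (n + 1 + k) + H) :
    Tendsto (fun n : ℕ ↦ (d.factorial : ℝ) * L n / (n : ℝ) ^ d) atTop (𝓝 E) := by
  have hdf (n : ℕ) : d.factorial * (n + d).choose d = (n + d).descFactorial d :=
    (Nat.descFactorial_eq_factorial_mul_choose _ _).symm
  have hupper : Tendsto (fun n : ℕ ↦ (E : ℝ) * (((n : ℝ) + d) / n) ^ d) atTop (𝓝 E) := by
    simpa using (tendsto_add_natCast_div_pow d d).const_mul (E : ℝ)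
  have hlower : Tendsto (fun n : ℕ ↦ (E : ℝ) * (((n : ℝ) + -k) / n) ^ d -
      (d.factorial * H : ℝ) / (n : ℝ) ^ d) atTop (𝓝 E) := by
    have h1 : Tendsto (fun n : ℕ ↦ (d.factorial * H : ℝ) / (n : ℝ) ^ d) atTop (𝓝 0) :=
      Tendsto.div_atTop tendsto_const_nhds
        ((tendsto_pow_atTop (by lia)).comp tendsto_natCast_atTop_atTop)
    simpa using ((tendsto_add_natCast_div_pow (-k) d).const_mul (E : ℝ)).sub h1
  refine tendsto_of_tendsto_of_tendsto_of_le_of_le' hlower hupper ?_ ?_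
  · filter_upwards [eventually_ge_atTop (k + 1)] with n hn
    obtain ⟨m, rfl⟩ := Nat.exists_eq_add_of_le hn
    have hpos : (0 : ℝ) < ((k + 1 + m : ℕ) : ℝ) ^ d := by positivity
    -- The lower bound is shifted so that the argument is `n = k + 1 + m`; hence the leading term is
    -- `(n - k) ^ d`.
    have h1 : E * (m + 1) ^ d ≤ d.factorial * L (k + 1 + m) + d.factorial * H := by
      calc E * (m + 1) ^ d ≤ E * (m + d).descFactorial d := by
            refine Nat.mul_le_mul_left _ ?_
            have := Nat.pow_sub_le_descFactorial (m + d) d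
            rwa [show m + d + 1 - d = m + 1 by lia] at this
        _ = d.factorial * (E * (m + d).choose d) := by rw [← hdf]; ring
        _ ≤ d.factorial * (L (m + 1 + k) + H) := Nat.mul_le_mul_left _ (hlow m)
        _ = _ := by rw [show m + 1 + k = k + 1 + m by lia]; ring
    have h2 : (E : ℝ) * (m + 1) ^ d ≤ d.factorial * L (k + 1 + m) + d.factorial * H := by
      exact_mod_cast h1
    rw [div_pow, ← mul_div_assoc, ← sub_div, div_le_div_iff_of_pos_right hpos]
    have h3 : ((k + 1 + m : ℕ) : ℝ) + -k = m + 1 := by push_cast; ring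
    rw [h3]
    linarith
  · filter_upwards [eventually_gt_atTop 0] with n hn
    have hpos : (0 : ℝ) < (n : ℝ) ^ d := by positivity
    have h1 : d.factorial * L n ≤ E * (n + d) ^ d := by
      calc d.factorial * L n ≤ d.factorial * (E * (n + d).choose d) :=
            Nat.mul_le_mul_left _ (hup n)
        _ = E * (n + d).descFactorial d := by rw [← hdf]; ring
        _ ≤ _ := Nat.mul_le_mul_left _ (Nat.descFactorial_le_pow _ _)
    rw [div_pow, ← mul_div_assoc, div_le_div_iff_of_pos_right hpos]
    exact_mod_cast h1

end Limit

end

/-! ### Sections over the punctured spectrum and regularity of the parameters on them. -/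

section

open IsLocalRing

section Sections

variable (A : Type u) [CommRing A] [IsLocalRing A]

/-- The elements `f` of the total ring of fractions such that `𝔪ᵏ f ⊆ A` for some `k`. -/
def sectionModule : Submodule A (FractionRing A) :=
  (powTorsion (maximalIdeal A) (FractionRing A ⧸ (1 : Submodule A (FractionRing A)))).comap
    (Submodule.mkQ _)

variable {A}

lemma mem_sectionModule {f : FractionRing A} : f ∈ sectionModule A ↔
    ∃ k : ℕ, ∀ r ∈ maximalIdeal A ^ k, r • f ∈ (1 : Submodule A (FractionRing A)) := by
  simp only [sectionModule, Submodule.mem_comap, mem_powTorsion, Submodule.mkQ_apply,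
    ← Submodule.Quotient.mk_smul, Submodule.Quotient.mk_eq_zero]

lemma one_le_sectionModule : 1 ≤ sectionModule A := fun _ hf ↦
  mem_sectionModule.mpr ⟨0, fun _ _ ↦ Submodule.smul_mem _ _ hf⟩

lemma algebraMap_mem_sectionModule (s : A) : algebraMap A (FractionRing A) s ∈ sectionModule A :=
  one_le_sectionModule (Submodule.mem_one.mpr ⟨s, rfl⟩)

lemma mul_mem_sectionModule {f g : FractionRing A} (hf : f ∈ sectionModule A)
    (hg : g ∈ sectionModule A) : f * g ∈ sectionModule A := by
  obtain ⟨k, hk⟩ := mem_sectionModule.mp hf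
  obtain ⟨l, hl⟩ := mem_sectionModule.mp hg
  refine mem_sectionModule.mpr ⟨k + l, fun r hr ↦ ?_⟩
  rw [pow_add] at hr
  refine Submodule.mul_induction_on hr (fun s hs t ht ↦ ?_) fun s t hs ht ↦ ?_
  · rw [← smul_mul_smul_comm]
    simpa using Submodule.mul_mem_mul (hk s hs) (hl t ht)
  · rw [add_smul]
    exact add_mem hs ht

lemma exists_nonZeroDivisor_of_depthLocal_eq_one (h : depthLocal A A = 1) :
    ∃ r ∈ maximalIdeal A, r ∈ nonZeroDivisors A := by
  by_contra! hr
  have : depthLocal A A ≤ 0 := by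
    refine iSup_le fun rs ↦ iSup_le fun hm ↦ iSup_le fun hreg ↦ ?_
    rcases rs with _ | ⟨r, rs⟩
    · simp
    · refine absurd ?_ (hr r (hm r (by simp)))
      have := ((RingTheory.Sequence.isWeaklyRegular_cons_iff A r rs).mp hreg.1).1
      rw [mem_nonZeroDivisors_iff_right]
      intro z hz
      exact this.right_eq_zero_of_smul (by simpa [mul_comm] using hz)
  simp [h] at this

omit [IsLocalRing A] in
lemma bijective_smul_fractionRing {r : A} (hr : r ∈ nonZeroDivisors A) :
    Function.Bijective fun y : FractionRing A ↦ r • y := by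
  have := IsLocalization.map_units (FractionRing A) (⟨r, hr⟩ : nonZeroDivisors A)
  simp only [Algebra.smul_def]
  exact IsUnit.isUnit_iff_mulLeft_bijective.mp this

lemma eq_zero_of_pow_smul_eq_zero {r₀ : A} (h₀ : r₀ ∈ maximalIdeal A)
    (hr : r₀ ∈ nonZeroDivisors A) {k : ℕ} {z : FractionRing A}
    (hz : ∀ s ∈ maximalIdeal A ^ k, s • z = 0) : z = 0 :=
  (bijective_smul_fractionRing (pow_mem hr k)).1
    (by simpa using hz _ (Ideal.pow_mem_pow h₀ k))

omit [IsLocalRing A] in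
lemma algebraMap_fractionRing_injective : Function.Injective (algebraMap A (FractionRing A)) :=
  IsLocalization.injective _ le_rfl

/-- The regular element `r₀` acts bijectively on `Q(A)`, so `H¹_𝔪(A)` is the `𝔪`-power torsion of
`Q(A)/A`. -/
lemma mem_annH1_iff {r₀ : A} (h₀ : r₀ ∈ maximalIdeal A) (hr : r₀ ∈ nonZeroDivisors A) {r : A} :
    r ∈ annH1 A ↔ ∀ f ∈ sectionModule A, r • f ∈ (1 : Submodule A (FractionRing A)) := by
  rw [annH1, mem_annihilator_localCohomology_iff, forall_smul_ext_eq_zero_iff h₀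
    (i := Algebra.linearMap A (FractionRing A)) algebraMap_fractionRing_injective
    (bijective_smul_fractionRing hr), ← Submodule.one_eq_range]
  exact ⟨fun h f hf ↦ (mem_sectionModule.mp hf).elim fun k hk ↦ h f k hk,
    fun h f k hk ↦ h f (mem_sectionModule.mpr ⟨k, hk⟩)⟩

/-- `𝔠` is an ideal of `S`, because `S` is closed under multiplication. -/
lemma exists_mem_annH1_of_smul {r₀ : A} (h₀ : r₀ ∈ maximalIdeal A) (hr : r₀ ∈ nonZeroDivisors A)
    {r : A} (hc : r ∈ annH1 A) {f : FractionRing A} (hf : f ∈ sectionModule A) :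
    ∃ s ∈ annH1 A, algebraMap A (FractionRing A) s = r • f := by
  obtain ⟨s, hs⟩ := Submodule.mem_one.mp ((mem_annH1_iff h₀ hr).mp hc f hf)
  refine ⟨s, (mem_annH1_iff h₀ hr).mpr fun g hg ↦ ?_, hs⟩
  rw [Algebra.smul_def, hs, smul_mul_assoc]
  exact (mem_annH1_iff h₀ hr).mp hc _ (mul_mem_sectionModule hf hg)

end Sections

section Transfer

variable {R : Type u} [CommRing R] {J : Ideal R}

lemma ExtPowVanishes.of_iso {M N : ModuleCat.{u} R} (e : M ≅ N) {n : ℕ}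
    (h : ExtPowVanishes J n M) : ExtPowVanishes J n N := by
  intro k ξ
  obtain ⟨l, hl⟩ := h k (ξ.comp (Abelian.Ext.mk₀ e.inv) (add_zero n))
  refine ⟨l, ?_⟩
  have := congrArg (fun η ↦ Abelian.Ext.comp η (Abelian.Ext.mk₀ e.hom) (add_zero n)) hl
  simpa using this

/-- In degree zero the transition maps are injective: the projections between the `R ⧸ J ^ k` are
surjective. -/
lemma extPowVanishes_zero_iff {M : Type u} [AddCommGroup M] [Module R M] :
    ExtPowVanishes J 0 (ModuleCat.of R M) ↔
      ∀ (k : ℕ) (x : M), (∀ r ∈ J ^ k, r • x = 0) → x = 0 := by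
  constructor
  · intro h k x hx
    obtain ⟨⟨l, hl⟩, h⟩ := h k (Abelian.Ext.mk₀ (homOfMem _ x hx))
    rw [Abelian.Ext.mk₀_comp_mk₀, Abelian.Ext.mk₀_eq_zero_iff] at h
    have := congrArg (fun g ↦ g.hom (Submodule.Quotient.mk (1 : R))) h
    exact (homOfMem_one _ x hx).symm.trans this
  · intro h k ξ
    obtain ⟨f, rfl⟩ := (Abelian.Ext.mk₀_bijective _ _).2 ξ
    refine ⟨⟨k, le_rfl⟩, ?_⟩
    have : f = 0 := hom_ext_of_one (h k _ fun r hr ↦ smul_hom_mk_one f hr)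
    simp [this]

end Transfer

section StandardSystem

variable {A : Type u} [CommRing A] [IsLocalRing A] {d : ℕ} {a : Fin d → A}

lemma IsSystemOfParameters.mem_maximalIdeal (ha : IsSystemOfParameters a) (i : Fin d) :
    a i ∈ maximalIdeal A :=
  ha.2 ▸ Ideal.le_radical (Ideal.subset_span ⟨i, rfl⟩)

variable [IsNoetherianRing A]

lemma IsSystemOfParameters.exists_pow_le (ha : IsSystemOfParameters a) :
    ∃ k, maximalIdeal A ^ k ≤ Ideal.span (Set.range a) := by
  rw [← ha.2]
  exact Ideal.exists_radical_pow_le_of_fg _ (IsNoetherian.noetherian _)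

variable (ha : IsStandardSystemOfParameters a) {r₀ : A} (h₀ : r₀ ∈ maximalIdeal A)
  (hr : r₀ ∈ nonZeroDivisors A)
include ha h₀ hr

/-- Taking `T = ∅`, an element killed by one `a i` is killed by all of them, hence by a power of
`r₀`. -/
lemma IsStandardSystemOfParameters.mem_nonZeroDivisors (i : Fin d) :
    a i ∈ nonZeroDivisors A := by
  obtain ⟨k, hk⟩ := ha.1.exists_pow_le
  refine mem_nonZeroDivisors_iff_right.mpr fun z hz ↦ ?_
  have h : Ideal.span (Set.range a) ≤ (⊥ : Ideal A).colon {z} := by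
    rw [Ideal.span_le]
    rintro _ ⟨j, rfl⟩
    have := ha.mul_mem_of_mul_mem (T := ∅) (i := i) (j := j) (z := z) (by simp) (by simp)
      (by simpa [mul_comm] using hz)
    simpa [Submodule.mem_colon_singleton] using this
  have h' := h (hk (Ideal.pow_mem_pow h₀ k))
  rw [Submodule.mem_colon_singleton, Submodule.mem_bot, smul_eq_mul] at h'
  exact (mem_nonZeroDivisors_iff.mp (pow_mem hr k)).1 z h'

/-- Since `d ≥ 2` there is `j ≠ i`. Write `f = v / a_i^(N+1) = w / a_j^(N+1)`. Then `a_i^(N+1) w` is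
a multiple of `a_j^(N+1)`, so already `a_i w = a_j^(N+1) u`, and `a_i f = u`. -/
lemma IsStandardSystemOfParameters.smul_mem_one (hd : 2 ≤ d) (i : Fin d) {f : FractionRing A}
    (hf : f ∈ sectionModule A) : a i • f ∈ (1 : Submodule A (FractionRing A)) := by
  have : Nontrivial (Fin d) := Fin.nontrivial_iff_two_le.mpr hd
  obtain ⟨j, hj⟩ := exists_ne i
  obtain ⟨N, hN⟩ := mem_sectionModule.mp hf
  replace hN (l : Fin d) : a l ^ (N + 1) • f ∈ (1 : Submodule A (FractionRing A)) := by
    rw [pow_succ', mul_smul]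
    exact Submodule.smul_mem _ _ (hN _ (Ideal.pow_mem_pow (ha.1.mem_maximalIdeal l) N))
  obtain ⟨v, hv⟩ := Submodule.mem_one.mp (hN i)
  obtain ⟨w, hw⟩ := Submodule.mem_one.mp (hN j)
  have h : a i ^ (N + 1) * w ∈ Ideal.span {a j ^ (N + 1)} := by
    refine Ideal.mem_span_singleton.mpr ⟨v, algebraMap_fractionRing_injective ?_⟩
    rw [map_mul, map_mul, hv, hw, ← Algebra.smul_def, ← Algebra.smul_def, smul_comm]
  obtain ⟨u, hu⟩ := Ideal.mem_span_singleton.mp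
    (ha.mul_mem_of_pow_mul_mem hj.symm (by lia) (N + 1) h)
  refine Submodule.mem_one.mpr ⟨u, (bijective_smul_fractionRing
    (pow_mem (ha.mem_nonZeroDivisors h₀ hr j) (N + 1))).1 ?_⟩
  simp only
  rw [smul_comm, ← hw, Algebra.smul_def, ← map_mul, ← hu, map_mul, Algebra.smul_def]

lemma IsStandardSystemOfParameters.mem_annH1 (hd : 2 ≤ d) (i : Fin d) : a i ∈ annH1 A :=
  (mem_annH1_iff h₀ hr).mpr fun _ hf ↦ ha.smul_mem_one h₀ hr hd i hf

lemma IsStandardSystemOfParameters.span_le_annH1 (hd : 2 ≤ d) :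
    Ideal.span (Set.range a) ≤ annH1 A := by
  rw [Ideal.span_le]
  rintro _ ⟨i, rfl⟩
  exact ha.mem_annH1 h₀ hr hd i

omit ha [IsNoetherianRing A] in
lemma smul_sectionModule_le_of_le_annH1 {I : Ideal A} (hI : I ≤ annH1 A) :
    I • sectionModule A ≤ Submodule.map (Algebra.linearMap A (FractionRing A)) (annH1 A) := by
  refine Submodule.smul_le.mpr fun r hc f hf ↦ ?_
  obtain ⟨s, hs, h⟩ := exists_mem_annH1_of_smul h₀ hr (hI hc) hf
  exact ⟨s, hs, h⟩

lemma IsStandardSystemOfParameters.smul_mem_map (hd : 2 ≤ d) (l : Fin d) {I : Ideal A}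
    {y : FractionRing A} (hy : y ∈ I • sectionModule A) :
    a l • y ∈ Submodule.map (Algebra.linearMap A (FractionRing A)) I := by
  refine Submodule.smul_induction_on hy (fun r hI f hf ↦ ?_) fun x y hx hy ↦ ?_
  · obtain ⟨u, hu⟩ := Submodule.mem_one.mp (ha.smul_mem_one h₀ hr hd l hf)
    refine ⟨r * u, I.mul_mem_right u hI, ?_⟩
    rw [Algebra.linearMap_apply, smul_comm, ← hu, map_mul, Algebra.smul_def]
  · rw [smul_add]
    exact add_mem hx hy

omit ha h₀ hr [IsNoetherianRing A] in
lemma map_linearMap_le_smul_sectionModule (I : Ideal A) :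
    Submodule.map (Algebra.linearMap A (FractionRing A)) I ≤ I • sectionModule A := by
  rintro _ ⟨s, hs, rfl⟩
  rw [Algebra.linearMap_apply, Algebra.algebraMap_eq_smul_one]
  exact Submodule.smul_mem_smul hs (one_le_sectionModule (Submodule.mem_one.mpr ⟨1, map_one _⟩))

/-- `S` is Cohen–Macaulay. Degree zero holds because `r₀` is regular, and degree one because `S` is
saturated in `Q(A)`. In higher degrees `S` lies between `A`, whose cohomology vanishes by
hypothesis, and the torsion module `S/A`. -/
lemma IsStandardSystemOfParameters.extPowVanishes_sectionModule (hd : 2 ≤ d)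
    (hH : ∀ i : ℕ, i ≠ 1 → i ≠ d →
      Subsingleton ((localCohomology (maximalIdeal A) i).obj (ModuleCat.of A A)))
    {n : ℕ} (hn : n < d) :
    ExtPowVanishes (maximalIdeal A) n (ModuleCat.of A (sectionModule A)) := by
  obtain ⟨k, hk⟩ := ha.1.exists_pow_le
  have hann (r) (hrk : r ∈ maximalIdeal A ^ k) (f) (hf : f ∈ sectionModule A) :
      r • f ∈ (1 : Submodule A (FractionRing A)) :=
    (mem_annH1_iff h₀ hr).mp (ha.span_le_annH1 h₀ hr hd (hk hrk)) f hf
  match n with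
  | 0 =>
    refine extPowVanishes_zero_iff.mpr fun k x hx ↦ Subtype.ext ?_
    exact eq_zero_of_pow_smul_eq_zero h₀ hr fun s hs ↦ by simpa using congrArg (·.1) (hx s hs)
  | 1 =>
    refine extPowVanishes_one h₀ (i := (sectionModule A).subtype) Subtype.val_injective
      (bijective_smul_fractionRing hr) fun f l hf ↦ ?_
    rw [Submodule.range_subtype] at hf ⊢
    refine mem_sectionModule.mpr ⟨l + k, fun r hrl ↦ ?_⟩
    rw [pow_add] at hrl
    refine Submodule.mul_induction_on hrl (fun s hs t ht ↦ ?_) fun s t hs ht ↦ ?_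
    · rw [mul_comm, mul_smul]
      exact hann t ht _ (hf s hs)
    · rw [add_smul]
      exact add_mem hs ht
  | n + 2 =>
    let j : A →ₗ[A] sectionModule A := (Algebra.linearMap A (FractionRing A)).codRestrict _
      algebraMap_mem_sectionModule
    have hj : Function.Injective j := fun x y h ↦
      algebraMap_fractionRing_injective (congrArg (·.1) h)
    refine ExtPowVanishes.second (shortExact_of_exact hj (Submodule.mkQ_surjective _)
      (LinearMap.exact_map_mkQ_range j))
      (extPowVanishes_of_subsingleton_localCohomology (hH (n + 2) (by lia) (by lia)))
      (extPowVanishes_of_powTorsion_eq_top _ (eq_top_iff.mpr fun z _ ↦ ?_))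
    obtain ⟨f, rfl⟩ := Submodule.mkQ_surjective _ z
    refine mem_powTorsion.mpr ⟨k, fun r hrk ↦ ?_⟩
    rw [← map_smul, Submodule.mkQ_apply, Submodule.Quotient.mk_eq_zero]
    obtain ⟨s, hs⟩ := Submodule.mem_one.mp (hann r hrk f f.2)
    exact ⟨s, Subtype.ext hs⟩

/-- It suffices that `𝔮² z ⊆ (a_T)S`, since `S/(a_T)S` has no `𝔪`-power torsion. One factor `a l`
moves `z` into `A`; there `a i` can be replaced by any other `a j`. -/
lemma IsStandardSystemOfParameters.mem_of_smul_mem (hd : 2 ≤ d) {T : Finset (Fin d)} {i : Fin d}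
    (hi : i ∉ T) (h : ExtPowVanishes (maximalIdeal A) 0 (ModuleCat.of A
      (sectionModule A ⧸ Ideal.span (a '' T) • (⊤ : Submodule A (sectionModule A)))))
    {z : sectionModule A}
    (hz : a i • z ∈ Ideal.span (a '' T) • (⊤ : Submodule A (sectionModule A))) :
    z ∈ Ideal.span (a '' T) • (⊤ : Submodule A (sectionModule A)) := by
  obtain ⟨k, hk⟩ := ha.1.exists_pow_le
  rw [Submodule.mem_smul_top_iff] at hz
  have key (j l : Fin d) : a j • a l • (z : FractionRing A) ∈
      Ideal.span (a '' T) • sectionModule A := by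
    by_cases hj : j ∈ T
    · exact Submodule.smul_mem_smul (Ideal.subset_span ⟨j, hj, rfl⟩)
        (Submodule.smul_mem _ _ z.2)
    · obtain ⟨w, hw⟩ := Submodule.mem_one.mp (ha.smul_mem_one h₀ hr hd l z.2)
      obtain ⟨s, hs, hsw⟩ := ha.smul_mem_map h₀ hr hd l hz
      have : a i * w = s := algebraMap_fractionRing_injective <| by
        rw [map_mul, hw, ← Algebra.smul_def, smul_comm]
        exact hsw.symm
      refine map_linearMap_le_smul_sectionModule _
        ⟨a j * w, ha.mul_mem_of_mul_mem hi hj (this ▸ hs), ?_⟩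
      rw [Algebra.linearMap_apply, map_mul, hw, ← Algebra.smul_def]
  have key₂ : Ideal.span (Set.range a) * Ideal.span (Set.range a) ≤
      (Ideal.span (a '' T) • (⊤ : Submodule A (sectionModule A))).colon {z} := by
    rw [Ideal.span_mul_span', Ideal.span_le]
    rintro _ ⟨_, ⟨j, rfl⟩, _, ⟨l, rfl⟩, rfl⟩
    simp only [SetLike.mem_coe, Submodule.mem_colon_singleton]
    rw [Submodule.mem_smul_top_iff, mul_smul]
    exact key j l
  rw [← Submodule.Quotient.mk_eq_zero]
  refine extPowVanishes_zero_iff.mp h (k + k) _ fun r hrk ↦ ?_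
  rw [pow_add] at hrk
  have := key₂ (Ideal.mul_mono hk hk hrk)
  rw [Submodule.mem_colon_singleton] at this
  rwa [← Submodule.Quotient.mk_smul, Submodule.Quotient.mk_eq_zero]

/-- Induction on `T`: vanishing in degree zero for `T` makes `a i` regular on the quotient, and
dividing by it costs one degree of vanishing. -/
lemma IsStandardSystemOfParameters.extPowVanishes_quotient (hd : 2 ≤ d)
    (hH : ∀ i : ℕ, i ≠ 1 → i ≠ d →
      Subsingleton ((localCohomology (maximalIdeal A) i).obj (ModuleCat.of A A)))
    (T : Finset (Fin d)) {n : ℕ} (hn : n + T.card < d) :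
    ExtPowVanishes (maximalIdeal A) n (ModuleCat.of A
      (sectionModule A ⧸ Ideal.span (a '' T) • (⊤ : Submodule A (sectionModule A)))) := by
  induction T using Finset.induction generalizing n with
  | empty =>
    refine (ha.extPowVanishes_sectionModule h₀ hr hd hH (n := n) (by simpa using hn)).of_iso
      (Submodule.quotEquivOfEqBot _ ?_).symm.toModuleIso
    simp
  | insert i T hi ih =>
    rw [Finset.card_insert_of_notMem hi] at hn
    refine ExtPowVanishes.quotient (a := a i)
      (fun z ↦ ha.mem_of_smul_mem h₀ hr hd hi (ih (by lia))) (fun z ↦ ?_)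
      (ih (by lia)) (ih (by lia))
    rw [← smul_top_sup_span_singleton, Submodule.mem_sup]
    constructor
    · rintro ⟨y, hy, w, hw, rfl⟩
      obtain ⟨w, -, rfl⟩ := mem_span_singleton_smul_iff.mp hw
      exact ⟨w, by simpa using hy⟩
    · rintro ⟨w, hw⟩
      exact ⟨_, hw, a i • w, mem_span_singleton_smul_iff.mpr ⟨w, trivial, rfl⟩, by simp⟩

lemma IsStandardSystemOfParameters.isPermutablyRegular (hd : 2 ≤ d)
    (hH : ∀ i : ℕ, i ≠ 1 → i ≠ d →
      Subsingleton ((localCohomology (maximalIdeal A) i).obj (ModuleCat.of A A))) :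
    IsPermutablyRegular a Finset.univ (sectionModule A) := by
  intro T _ i _ hi z hz
  refine ha.mem_of_smul_mem h₀ hr hd hi (ha.extPowVanishes_quotient h₀ hr hd hH T ?_) hz
  have := Finset.card_lt_univ_of_notMem hi
  simpa using this

/-- Regularity, read inside the total ring of fractions. -/
lemma IsStandardSystemOfParameters.mem_smul_of_smul_mem (hd : 2 ≤ d)
    (hH : ∀ i : ℕ, i ≠ 1 → i ≠ d →
      Subsingleton ((localCohomology (maximalIdeal A) i).obj (ModuleCat.of A A)))
    {T : Finset (Fin d)} {i : Fin d} (hi : i ∉ T) {f : FractionRing A} (hf : f ∈ sectionModule A)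
    (h : a i • f ∈ Ideal.span (a '' T) • sectionModule A) :
    f ∈ Ideal.span (a '' T) • sectionModule A := by
  have := ha.isPermutablyRegular h₀ hr hd hH T (Finset.subset_univ _) i (Finset.mem_univ _) hi
    ⟨f, hf⟩
  rw [Submodule.mem_smul_top_iff, Submodule.mem_smul_top_iff] at this
  exact this h

/-- Each summand `(a_j ∣ j ≠ i) : a_i` equals `(a_j ∣ j ≠ i)S`: one inclusion is regularity of `a_i`
on `S/(a_j ∣ j ≠ i)S`, the other is `a_i S ⊆ A`. As `d ≥ 2`, every `a_j` occurs in some summand. -/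
lemma IsStandardSystemOfParameters.map_sigmaTilde (hd : 2 ≤ d)
    (hH : ∀ i : ℕ, i ≠ 1 → i ≠ d →
      Subsingleton ((localCohomology (maximalIdeal A) i).obj (ModuleCat.of A A))) :
    Submodule.map (Algebra.linearMap A (FractionRing A)) (sigmaTilde a) =
      Ideal.span (Set.range a) • sectionModule A := by
  have key (i : Fin d) : Submodule.map (Algebra.linearMap A (FractionRing A))
      ((Ideal.span (a '' {j | j ≠ i})).colon {a i}) =
      Ideal.span (a '' {j | j ≠ i}) • sectionModule A := by
    have hT : ({j | j ≠ i} : Set (Fin d)) = (({i}ᶜ : Finset (Fin d)) : Set (Fin d)) := by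
      ext; simp
    rw [hT]
    apply le_antisymm
    · rintro _ ⟨s, hs, rfl⟩
      refine ha.mem_smul_of_smul_mem h₀ hr hd hH (i := i) (by simp)
        (algebraMap_mem_sectionModule s) (map_linearMap_le_smul_sectionModule _
          ⟨s * a i, Submodule.mem_colon_singleton.mp hs, ?_⟩)
      simp [Algebra.smul_def, mul_comm]
    · intro y hy
      obtain ⟨s, -, rfl⟩ := smul_sectionModule_le_of_le_annH1 h₀ hr
        ((Ideal.span_mono (Set.image_subset_range _ _)).trans (ha.span_le_annH1 h₀ hr hd)) hy
      refine ⟨s, Submodule.mem_colon_singleton.mpr ?_, rfl⟩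
      obtain ⟨t, ht, hts⟩ := ha.smul_mem_map h₀ hr hd i hy
      have : s * a i = t := algebraMap_fractionRing_injective <| by
        rw [map_mul, mul_comm, ← Algebra.smul_def]
        exact hts.symm
      rwa [smul_eq_mul, this]
  rw [sigmaTilde, Submodule.map_iSup]
  simp_rw [key]
  apply le_antisymm
  · exact iSup_le fun i ↦ Submodule.smul_mono_left (Ideal.span_mono (Set.image_subset_range _ _))
  · have : Nontrivial (Fin d) := Fin.nontrivial_iff_two_le.mpr hd
    rw [← Submodule.iSup_smul]
    refine Submodule.smul_mono_left (Ideal.span_le.mpr ?_)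
    rintro _ ⟨j, rfl⟩
    obtain ⟨i, hi⟩ := exists_ne j
    exact Ideal.mem_iSup_of_mem i (Ideal.subset_span ⟨j, hi.symm, rfl⟩)

end StandardSystem

end

/-! ### Lengths, multiplicity and the equivalence. -/

section

open IsLocalRing

section Multiplicity

variable {A : Type u} [CommRing A] [IsLocalRing A] {d : ℕ} {a : Fin d → A}

/-- The inclusion of `A` into its module of sections. -/
noncomputable def toSectionModule (A : Type u) [CommRing A] [IsLocalRing A] :
    A →ₗ[A] sectionModule A :=
  (Algebra.linearMap A (FractionRing A)).codRestrict _ algebraMap_mem_sectionModule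

lemma mem_range_toSectionModule {z : sectionModule A} :
    z ∈ LinearMap.range (toSectionModule A) ↔ (z : FractionRing A) ∈
      (1 : Submodule A (FractionRing A)) := by
  rw [Submodule.mem_one]
  exact exists_congr fun s ↦ Subtype.ext_iff

/-- `𝔠` as a submodule of the module of sections. -/
noncomputable abbrev annH1Sections (A : Type u) [CommRing A] [IsLocalRing A] :
    Submodule A (sectionModule A) :=
  Submodule.map (toSectionModule A) (annH1 A)

lemma mem_annH1Sections {z : sectionModule A} : z ∈ annH1Sections A ↔ (z : FractionRing A) ∈
    Submodule.map (Algebra.linearMap A (FractionRing A)) (annH1 A) :=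
  exists_congr fun _ ↦ and_congr_right fun _ ↦ Subtype.ext_iff

omit [IsLocalRing A] in
lemma map_algebraLinearMap_injective : Function.Injective
    (Submodule.map (Algebra.linearMap A (FractionRing A))) :=
  Submodule.map_injective_of_injective algebraMap_fractionRing_injective

lemma smul_top_eq_annH1Sections_iff {I : Ideal A} :
    I • (⊤ : Submodule A (sectionModule A)) = annH1Sections A ↔
      Submodule.map (Algebra.linearMap A (FractionRing A)) (annH1 A) = I • sectionModule A := by
  have h₁ : Submodule.map (Algebra.linearMap A (FractionRing A)) (annH1 A) ≤ sectionModule A := by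
    rintro _ ⟨s, -, rfl⟩
    exact algebraMap_mem_sectionModule s
  have h₂ : I • sectionModule A ≤ sectionModule A := Submodule.smul_le_right
  simp only [Submodule.ext_iff, mem_annH1Sections, Submodule.mem_smul_top_iff]
  exact ⟨fun h f ↦ ⟨fun hf ↦ (h ⟨f, h₁ hf⟩).mpr hf, fun hf ↦ (h ⟨f, h₂ hf⟩).mp hf⟩,
    fun h f ↦ (h f).symm⟩

variable [IsNoetherianRing A] {r₀ : A} (h₀ : r₀ ∈ maximalIdeal A)
  (hr : r₀ ∈ nonZeroDivisors A)
include h₀ hr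

omit [IsNoetherianRing A] in
-- `Ext¹(A/𝔪, A)` is `Hom(A/𝔪, Q(A)/A)`, and the socle of `Q(A)/A` lies in `S/A`.
lemma exists_socle_sectionModule (hdepth : depthLocal A A = 1) (htype : typeLocal A A = 1) :
    (∃ f ∈ sectionModule A, f ∉ (1 : Submodule A (FractionRing A))) ∧
      ∀ f g : FractionRing A, f ∉ (1 : Submodule A (FractionRing A)) →
        (∀ s ∈ maximalIdeal A, s • f ∈ (1 : Submodule A (FractionRing A))) →
        (∀ s ∈ maximalIdeal A, s • g ∈ (1 : Submodule A (FractionRing A))) →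
        ∃ r : A, g - r • f ∈ (1 : Submodule A (FractionRing A)) := by
  have h := exists_socle_of_length_ext_eq_one (M := A) h₀
    (i := Algebra.linearMap A (FractionRing A)) algebraMap_fractionRing_injective
    (bijective_smul_fractionRing hr) (by
      rw [typeLocal, hdepth] at htype
      exact htype)
  rw [← Submodule.one_eq_range] at h
  obtain ⟨⟨f, hf, hs⟩, h⟩ := h
  exact ⟨⟨f, mem_sectionModule.mpr ⟨1, by simpa using hs⟩, hf⟩, h⟩

omit [IsNoetherianRing A] in
lemma annH1_le_maximalIdeal (hdepth : depthLocal A A = 1) (htype : typeLocal A A = 1) :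
    annH1 A ≤ maximalIdeal A := by
  refine le_maximalIdeal fun h ↦ ?_
  obtain ⟨⟨f, hf, hf'⟩, -⟩ := exists_socle_sectionModule h₀ hr hdepth htype
  exact hf' (by simpa using (mem_annH1_iff h₀ hr).mp ((Ideal.eq_top_iff_one _).mp h) f hf)

omit [IsNoetherianRing A] in
lemma annihilator_sectionModule_quotient :
    Module.annihilator A (sectionModule A ⧸ LinearMap.range (toSectionModule A)) = annH1 A := by
  ext r
  rw [mem_annH1_iff h₀ hr, Module.mem_annihilator]
  constructor
  · intro h f hf
    have := h (Submodule.Quotient.mk ⟨f, hf⟩)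
    rw [← Submodule.Quotient.mk_smul, Submodule.Quotient.mk_eq_zero,
      mem_range_toSectionModule] at this
    exact this
  · intro h z
    obtain ⟨f, rfl⟩ := Submodule.mkQ_surjective _ z
    rw [Submodule.mkQ_apply, ← Submodule.Quotient.mk_smul, Submodule.Quotient.mk_eq_zero,
      mem_range_toSectionModule]
    exact h f f.2

omit [IsNoetherianRing A] in
lemma hasSimpleSocle_sectionModule_quotient (hdepth : depthLocal A A = 1)
    (htype : typeLocal A A = 1) :
    HasSimpleSocle A (sectionModule A ⧸ LinearMap.range (toSectionModule A)) := by
  intro z w hz hw hz0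
  obtain ⟨f, rfl⟩ := Submodule.mkQ_surjective _ z
  obtain ⟨g, rfl⟩ := Submodule.mkQ_surjective _ w
  simp only [Submodule.mkQ_apply, ← Submodule.Quotient.mk_smul, ne_eq,
    Submodule.Quotient.mk_eq_zero, mem_range_toSectionModule] at hz hw hz0 ⊢
  obtain ⟨r, hrr⟩ := (exists_socle_sectionModule h₀ hr hdepth htype).2 f g hz0 hz hw
  refine ⟨r, (Submodule.Quotient.eq _).mpr ?_⟩
  rw [mem_range_toSectionModule]
  exact hrr

variable (ha : IsStandardSystemOfParameters a) (hd : 2 ≤ d)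
include ha hd

/-- Multiplication by a single parameter embeds `S` in the Noetherian module `A`. -/
lemma IsStandardSystemOfParameters.finite_sectionModule : Module.Finite A (sectionModule A) := by
  let φ : sectionModule A →ₗ[A] (1 : Submodule A (FractionRing A)) :=
    (LinearMap.lsmul A (FractionRing A) (a ⟨0, by lia⟩)).restrict
      fun f hf ↦ ha.smul_mem_one h₀ hr hd _ hf
  have : IsNoetherian A (1 : Submodule A (FractionRing A)) := by
    rw [Submodule.one_eq_range]
    infer_instance
  have : IsNoetherian A (sectionModule A) := isNoetherian_of_injective φ fun x y h ↦
    Subtype.ext ((bijective_smul_fractionRing (ha.mem_nonZeroDivisors h₀ hr _)).1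
      (congrArg (·.1) h))
  infer_instance

lemma IsStandardSystemOfParameters.isFiniteLength_sectionModule_quotient :
    IsFiniteLength A (sectionModule A ⧸ LinearMap.range (toSectionModule A)) := by
  have := ha.finite_sectionModule h₀ hr hd
  obtain ⟨k, hk⟩ := ha.1.exists_pow_le
  refine isFiniteLength_of_pow_smul_eq_zero (k := k) fun r hrk ↦ ?_
  rw [← Module.mem_annihilator, annihilator_sectionModule_quotient h₀ hr]
  exact ha.span_le_annH1 h₀ hr hd (hk hrk)

variable (hdepth : depthLocal A A = 1) (htype : typeLocal A A = 1)
include hdepth htype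

/-- In the chain `𝔠 ⊆ A ⊆ S`, the module `S/A` has finite length, simple socle and annihilator `𝔠`,
so both steps have length `ℓ(A/𝔠)`. -/
lemma IsStandardSystemOfParameters.length_sectionModule_quotient_annH1 :
    Module.length A (sectionModule A ⧸ annH1Sections A) = 2 * Module.length A (A ⧸ annH1 A) := by
  have hj : Function.Injective (toSectionModule A) := fun x y h ↦
    algebraMap_fractionRing_injective (congrArg (·.1) h)
  rw [length_quotient_add (LinearMap.map_le_range (f := toSectionModule A) (p := annH1 A)),
    (hasSimpleSocle_sectionModule_quotient h₀ hr hdepth htype).length_eq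
      (ha.isFiniteLength_sectionModule_quotient h₀ hr hd),
    annihilator_sectionModule_quotient h₀ hr, two_mul]
  congr 1
  refine LinearEquiv.length_eq (Submodule.Quotient.equiv _ _ (LinearEquiv.ofInjective _ hj) ?_).symm
  ext ⟨_, s, rfl⟩
  simp only [Submodule.mem_map, Submodule.mem_comap, Submodule.subtype_apply]
  exact exists_congr fun t ↦ and_congr_right fun _ ↦ Subtype.ext_iff

omit hdepth htype in
lemma IsStandardSystemOfParameters.length_ne_top :
    Module.length A (sectionModule A ⧸
      (Ideal.span (Set.range a) • (⊤ : Submodule A (sectionModule A)))) ≠ ⊤ := by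
  have := ha.finite_sectionModule h₀ hr hd
  obtain ⟨k, hk⟩ := ha.1.exists_pow_le
  rw [Module.length_ne_top_iff]
  refine isFiniteLength_of_pow_smul_eq_zero (k := k) fun r hrk z ↦ ?_
  obtain ⟨f, rfl⟩ := Submodule.mkQ_surjective _ z
  rw [Submodule.mkQ_apply, ← Submodule.Quotient.mk_smul, Submodule.Quotient.mk_eq_zero]
  exact Submodule.smul_mem_smul (hk hrk) trivial

variable (hH : ∀ i : ℕ, i ≠ 1 → i ≠ d →
  Subsingleton ((localCohomology (maximalIdeal A) i).obj (ModuleCat.of A A)))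
include hH

/-- The lengths `ℓ(A/𝔠ⁿ)` are squeezed between shifts of `ℓ(S/𝔮ⁿ⁺¹S) = ℓ(S/𝔮S) · C(n+d, d)`, up to
the constant `ℓ(S/A)`. -/
lemma IsStandardSystemOfParameters.hasMultiplicity_annH1
    (hred : IsReductionOf (Ideal.span (Set.range a)) (annH1 A)) :
    HasMultiplicity (annH1 A) (Module.length A (sectionModule A ⧸
      (Ideal.span (Set.range a) • (⊤ : Submodule A (sectionModule A))))).toNat := by
  obtain ⟨hle, n₀, hn₀⟩ := hred
  refine ⟨le_antisymm ?_ ?_, d, ha.1.1, ?_⟩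
  · exact (Ideal.IsPrime.radical_le_iff inferInstance).mpr
      (annH1_le_maximalIdeal h₀ hr hdepth htype)
  · exact ha.1.2 ▸ Ideal.radical_mono hle
  set q := Ideal.span (Set.range a) with hq
  have hE := ha.length_ne_top h₀ hr hd
  obtain ⟨E, hE⟩ := ENat.ne_top_iff_exists.mp hE
  rw [← hq] at hE
  rw [← hE, ENat.toNat_natCast]
  have hlen (n : ℕ) : Module.length A (sectionModule A ⧸
      (q ^ (n + 1) • (⊤ : Submodule A (sectionModule A)))) = (E * (n + d).choose d : ℕ) := by
    have := (ha.isPermutablyRegular h₀ hr hd hH).length_quotient_pow n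
    rw [Finset.coe_univ, Set.image_univ, Finset.card_univ, Fintype.card_fin, ← hq, ← hE] at this
    rw [this]
    norm_cast
  -- `𝔮S ⊆ A` gives `𝔮ⁿ⁺¹S ∩ A ⊆ 𝔮ⁿ ⊆ 𝔠ⁿ`.
  have hup (n : ℕ) : Module.length A (A ⧸ annH1 A ^ n) ≤ (E * (n + d).choose d : ℕ) := by
    rw [← hlen]
    refine length_quotient_le_of_comap_le (toSectionModule A) fun s hs ↦ ?_
    refine Ideal.pow_right_mono hle n ?_
    rw [pow_succ, mul_smul, Submodule.mem_comap] at hs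
    have : Submodule.map (sectionModule A).subtype
        (q ^ n • q • (⊤ : Submodule A (sectionModule A))) ≤
        Submodule.map (Algebra.linearMap A (FractionRing A)) (q ^ n) := by
      rw [Submodule.map_smul'', Submodule.map_smul'', Submodule.map_top, Submodule.range_subtype]
      refine Submodule.smul_le.mpr fun r hrq f hf ↦ ?_
      obtain ⟨t, -, rfl⟩ := smul_sectionModule_le_of_le_annH1 h₀ hr hle hf
      refine ⟨r * t, Ideal.mul_mem_right _ _ hrq, ?_⟩
      simp [Algebra.smul_def]
    obtain ⟨t, ht, hts⟩ := this ⟨_, hs, rfl⟩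
    rwa [← algebraMap_fractionRing_injective hts]
  have hfin (n : ℕ) : ((Module.length A (A ⧸ annH1 A ^ n)).toNat : ℕ∞) =
      Module.length A (A ⧸ annH1 A ^ n) :=
    ENat.natCast_toNat (ne_top_of_le_ne_top (ENat.natCast_ne_top _) (hup n))
  have hpow (n : ℕ) : annH1 A ^ (n + n₀) ≤ q ^ n := by
    have : annH1 A ^ (n + n₀) = q ^ n * annH1 A ^ n₀ := by
      induction n with
      | zero => simp
      | succ n ih =>
        rw [show n + 1 + n₀ = (n + n₀) + 1 by ring, pow_succ', ih, mul_left_comm, ← pow_succ', hn₀,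
          pow_succ, mul_assoc]
    rw [this]
    exact Ideal.mul_le_left
  have hH' : Module.length A (sectionModule A ⧸ LinearMap.range (toSectionModule A)) ≠ ⊤ :=
    Module.length_ne_top_iff.mpr (ha.isFiniteLength_sectionModule_quotient h₀ hr hd)
  obtain ⟨H, hH'⟩ := ENat.ne_top_iff_exists.mp hH'
  refine tendsto_of_le_choose (k := n₀) (H := H) (by lia) (fun n ↦ ?_) fun n ↦ ?_
  · have := hup n
    rw [← hfin] at this
    exact_mod_cast this
  -- The reduction property gives `𝔠^(n+1+n₀) ⊆ 𝔮ⁿ⁺¹`, so `S/𝔮ⁿ⁺¹S` is bounded by `A/𝔠^(n+1+n₀)`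
  -- together with `S/A`.
  · have := length_quotient_le_add (toSectionModule A)
      (X := q ^ (n + 1) • (⊤ : Submodule A (sectionModule A)))
      (Y := annH1 A ^ (n + 1 + n₀)) fun s hs ↦ ?_
    · rw [hlen, ← hfin, ← hH'] at this
      exact_mod_cast this
    · rw [Submodule.mem_comap]
      have h1 := Submodule.smul_mem_smul (hpow (n + 1) hs)
        (Submodule.mem_top (x := toSectionModule A 1))
      rwa [← map_smul, smul_eq_mul, mul_one] at h1

omit hdepth htype in
lemma IsStandardSystemOfParameters.sigmaTilde_eq_annH1_iff :
    sigmaTilde a = annH1 A ↔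
      Ideal.span (Set.range a) • (⊤ : Submodule A (sectionModule A)) = annH1Sections A := by
  rw [smul_top_eq_annH1Sections_iff, ← ha.map_sigmaTilde h₀ hr hd hH,
    map_algebraLinearMap_injective.eq_iff, eq_comm]

omit hdepth htype in
-- From `𝔠 = 𝔮S` and `S𝔠 = 𝔠` one gets `𝔠² = 𝔮S𝔠 = 𝔮𝔠`, so the reduction exponent is `1`.
lemma IsStandardSystemOfParameters.isReductionOf_of_sigmaTilde_eq (h : sigmaTilde a = annH1 A) :
    IsReductionOf (Ideal.span (Set.range a)) (annH1 A) := by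
  have hle := ha.span_le_annH1 h₀ hr hd
  have hmap := ha.map_sigmaTilde h₀ hr hd hH
  rw [h] at hmap
  refine ⟨hle, 1, le_antisymm ?_ ?_⟩
  · rw [one_add_one_eq_two, pow_one, pow_two]
    refine Ideal.mul_le.mpr fun s hs t ht ↦ ?_
    have : Submodule.map (LinearMap.mulRight A (algebraMap A (FractionRing A) t))
        (Ideal.span (Set.range a) • sectionModule A) ≤
        Submodule.map (Algebra.linearMap A (FractionRing A))
          (Ideal.span (Set.range a) * annH1 A) := by
      rw [Submodule.map_smul'']
      refine Submodule.smul_le.mpr ?_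
      rintro r hrq _ ⟨f, hf, rfl⟩
      obtain ⟨v, hv, hvt⟩ := exists_mem_annH1_of_smul h₀ hr ht hf
      refine ⟨r * v, Ideal.mul_mem_mul hrq hv, ?_⟩
      simp [hvt, Algebra.smul_def, mul_comm]
    have hsm : algebraMap A (FractionRing A) s ∈ Ideal.span (Set.range a) • sectionModule A := by
      rw [← hmap]
      exact ⟨s, hs, rfl⟩
    obtain ⟨v, hv, hvs⟩ := this ⟨_, hsm, rfl⟩
    have : v = s * t := algebraMap_fractionRing_injective (by simpa using hvs)
    exact this ▸ hv
  · rw [pow_add, pow_one]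
    exact Ideal.mul_mono_left hle

theorem IsStandardSystemOfParameters.sigmaTilde_eq_annH1_iff_multiplicity :
    sigmaTilde a = annH1 A ↔
      (∃ e : ℕ, HasMultiplicity (annH1 A) e ∧
        (e : ℕ∞) = 2 * Module.length A (A ⧸ annH1 A)) ∧
      IsReductionOf (Ideal.span (Set.range a)) (annH1 A) := by
  have hfin := ha.length_ne_top h₀ hr hd
  constructor
  · intro h
    have hred := ha.isReductionOf_of_sigmaTilde_eq h₀ hr hd hH h
    refine ⟨⟨_, ha.hasMultiplicity_annH1 h₀ hr hd hdepth htype hH hred, ?_⟩, hred⟩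
    rw [ENat.natCast_toNat hfin, (ha.sigmaTilde_eq_annH1_iff h₀ hr hd hH).mp h,
      ha.length_sectionModule_quotient_annH1 h₀ hr hd hdepth htype]
  · rintro ⟨⟨e, ⟨-, d', hd', he⟩, he2⟩, hred⟩
    obtain ⟨-, d'', hd'', hE⟩ := ha.hasMultiplicity_annH1 h₀ hr hd hdepth htype hH hred
    obtain rfl : d' = d'' := by
      rw [hd'] at hd''
      exact_mod_cast hd''
    have heE := tendsto_nhds_unique he hE
    rw [Nat.cast_inj] at heE
    rw [ha.sigmaTilde_eq_annH1_iff h₀ hr hd hH]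
    -- `𝔮S ⊆ 𝔠` always; by uniqueness of the limit both have the same finite colength in `S`.
    refine eq_of_length_quotient_eq (fun z hz ↦ ?_) ?_ hfin
    · rw [mem_annH1Sections]
      exact smul_sectionModule_le_of_le_annH1 h₀ hr (ha.span_le_annH1 h₀ hr hd)
        ((Submodule.mem_smul_top_iff _ _ _).mp hz)
    · rw [ha.length_sectionModule_quotient_annH1 h₀ hr hd hdepth htype, ← he2, heE,
        ENat.natCast_toNat hfin]

end Multiplicity

end

/-! ### The ring `Ã` and the Gorenstein quotient. -/

section

open IsLocalRing

section TildeRing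

variable {A : Type u} [CommRing A] [IsLocalRing A] {r₀ : A} (h₀ : r₀ ∈ maximalIdeal A)
  (hr : r₀ ∈ nonZeroDivisors A)
include h₀ hr

/-- If `s y ∈ xA`, filter regularity gives `𝔪ⁿ s ⊆ xA`, so `s/x ∈ S`. Conversely, for `f ∈ S` both
`x f` and `y f` lie in `A`, and `(x f) y = x (y f)`. -/
lemma tildeRing_eq_sectionModule {x y : A} (hx : x ∈ annH1 A) (hy : y ∈ annH1 A)
    (h : IsFilterRegularPair x y) : tildeRing x y = sectionModule A := by
  obtain ⟨-, -, h0, hxy⟩ := h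
  have hx0 : x ∈ nonZeroDivisors A := by
    refine mem_nonZeroDivisors_iff_right.mpr fun z hz ↦ ?_
    obtain ⟨n, hn⟩ := h0 z (by simpa [Submodule.mem_colon_singleton] using hz)
    rw [Submodule.mem_colon] at hn
    have := hn _ (Ideal.pow_mem_pow h₀ n)
    rw [Submodule.mem_bot, smul_eq_mul] at this
    exact (mem_nonZeroDivisors_iff.mp (pow_mem hr n)).2 z this
  ext f
  simp only [tildeRing, Submodule.mem_comap, LinearMap.lsmul_apply, Submodule.mem_map,
    Algebra.linearMap_apply, Submodule.mem_colon_singleton, smul_eq_mul]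
  constructor
  · rintro ⟨s, hs, hsf⟩
    obtain ⟨n, hn⟩ := hxy s (Submodule.mem_colon_singleton.mpr hs)
    rw [Submodule.mem_colon] at hn
    refine mem_sectionModule.mpr ⟨n, fun r hrn ↦ ?_⟩
    obtain ⟨t, ht⟩ := Ideal.mem_span_singleton.mp (hn r hrn)
    refine Submodule.mem_one.mpr ⟨t, (bijective_smul_fractionRing hx0).1 ?_⟩
    simp only
    rw [smul_comm, ← hsf, Algebra.smul_def, Algebra.smul_def, ← map_mul, ← map_mul, ← ht,
      smul_eq_mul, mul_comm]
  · intro hf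
    obtain ⟨s, hs⟩ := Submodule.mem_one.mp ((mem_annH1_iff h₀ hr).mp hx f hf)
    obtain ⟨t, ht⟩ := Submodule.mem_one.mp ((mem_annH1_iff h₀ hr).mp hy f hf)
    refine ⟨s, Ideal.mem_span_singleton.mpr ⟨t, algebraMap_fractionRing_injective ?_⟩, hs⟩
    rw [map_mul, map_mul, hs, ht, mul_comm, ← Algebra.smul_def, ← Algebra.smul_def, smul_comm]

end TildeRing

section Gorenstein

variable {A : Type u} [CommRing A] [IsLocalRing A] [IsNoetherianRing A]

/-- A local quotient `f : A → C` annihilating a power of the maximal ideal is self-injective if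
its socle, described in `A`, is simple. -/
lemma baer_self_of_surjective {C : Type u} [CommRing C] [IsLocalRing C] (f : A →+* C)
    (hf : Function.Surjective f) {k : ℕ} (hk : ∀ r ∈ maximalIdeal A ^ k, f r = 0)
    (hs : ∀ z w : A, (∀ r ∈ maximalIdeal A, f (r * z) = 0) →
      (∀ r ∈ maximalIdeal A, f (r * w) = 0) → f z ≠ 0 → ∃ r, f w = f (r * z)) :
    Module.Baer C C := by
  have := isArtinianRing_of_pow_maximalIdeal_le f hf hk
  have hloc := hf.isLocalHom
  refine baer_self_of_hasSimpleSocle fun z w hz hw hz0 ↦ ?_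
  obtain ⟨z, rfl⟩ := hf z
  obtain ⟨w, rfl⟩ := hf w
  have hm (r : A) (hrm : r ∈ maximalIdeal A) : f r ∈ maximalIdeal C := by
    rwa [mem_maximalIdeal, mem_nonunits_iff, isUnit_map_iff, ← mem_nonunits_iff,
      ← mem_maximalIdeal]
  obtain ⟨r, hrr⟩ := hs z w (fun r hrm ↦ by simpa using hz _ (hm r hrm))
    (fun r hrm ↦ by simpa using hw _ (hm r hrm)) hz0
  exact ⟨f r, by simpa using hrr⟩

variable {d : ℕ} {a : Fin d → A} {r₀ : A}

/-- With `𝔟 = (a_T)S` and `B = A/𝔟`, the element `a l` is regular on `S/𝔟`, hence on `B`. It remains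
to see that `B/(a l)B` has simple socle, which is inherited from `S/A` by division by `a l`. -/
theorem IsStandardSystemOfParameters.isGorensteinLocalRing_quotient
    (ha : IsStandardSystemOfParameters a) (h₀ : r₀ ∈ maximalIdeal A)
    (hr : r₀ ∈ nonZeroDivisors A) (hd : 2 ≤ d) (hdepth : depthLocal A A = 1)
    (htype : typeLocal A A = 1)
    (hH : ∀ i : ℕ, i ≠ 1 → i ≠ d →
      Subsingleton ((localCohomology (maximalIdeal A) i).obj (ModuleCat.of A A)))
    (h : Submodule.map (Algebra.linearMap A (FractionRing A)) (annH1 A) =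
      Ideal.span (Set.range a) • sectionModule A)
    {T : Finset (Fin d)} {l : Fin d} (hlT : l ∉ T) (hT : insert l T = Finset.univ) :
    IsGorensteinLocalRing (A ⧸ (Submodule.comap (Algebra.linearMap A (FractionRing A))
      (Ideal.span (a '' T) • sectionModule A) : Ideal A)) := by
  set 𝔟 : Ideal A := Submodule.comap (Algebra.linearMap A (FractionRing A))
    (Ideal.span (a '' T) • sectionModule A) with h𝔟
  have hmem (s : A) : s ∈ 𝔟 ↔ algebraMap A (FractionRing A) s ∈
      Ideal.span (a '' T) • sectionModule A := Iff.rfl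
  have hTc : Ideal.span (a '' T) ≤ annH1 A :=
    (Ideal.span_mono (Set.image_subset_range _ _)).trans (ha.span_le_annH1 h₀ hr hd)
  have hcm := annH1_le_maximalIdeal h₀ hr hdepth htype
  have hone {f : FractionRing A} (hf : f ∈ Ideal.span (a '' T) • sectionModule A) :
      ∃ s ∈ 𝔟, algebraMap A (FractionRing A) s = f := by
    obtain ⟨s, -, rfl⟩ := smul_sectionModule_le_of_le_annH1 h₀ hr hTc hf
    exact ⟨s, hf, rfl⟩
  have h𝔟c : 𝔟 ≤ annH1 A := fun s hs ↦ by
    obtain ⟨t, ht, hts⟩ := smul_sectionModule_le_of_le_annH1 h₀ hr hTc ((hmem s).mp hs)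
    exact algebraMap_fractionRing_injective hts ▸ ht
  have hreg {f : FractionRing A} (hf : f ∈ sectionModule A)
      (h : a l • f ∈ Ideal.span (a '' T) • sectionModule A) :
      f ∈ Ideal.span (a '' T) • sectionModule A :=
    ha.mem_smul_of_smul_mem h₀ hr hd hH hlT hf h
  -- If `a l * f` and `a l * s` agree modulo `(a_T)S`, cancelling `a l` gives `f - s ∈ (a_T)S ⊆ A`.
  have hregb {f : FractionRing A} (hf : f ∈ sectionModule A) {s : A}
      (h : a l • f - algebraMap A (FractionRing A) (a l * s) ∈
        Ideal.span (a '' T) • sectionModule A) : f ∈ (1 : Submodule A (FractionRing A)) := by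
    rw [map_mul, ← Algebra.smul_def, ← smul_sub] at h
    obtain ⟨t, -, ht⟩ := hone (hreg (sub_mem hf (algebraMap_mem_sectionModule s)) h)
    exact Submodule.mem_one.mpr ⟨t + s, by rw [map_add, ht, sub_add_cancel]⟩
  have hdec {z : A} (hz : z ∈ annH1 A) : ∃ g ∈ sectionModule A,
      algebraMap A (FractionRing A) z - a l • g ∈ Ideal.span (a '' T) • sectionModule A := by
    have : algebraMap A (FractionRing A) z ∈ Ideal.span (Set.range a) • sectionModule A := by
      rw [← h]
      exact ⟨z, hz, rfl⟩
    rw [← Set.image_univ, ← Finset.coe_univ, ← hT, span_image_insert, Submodule.sup_smul,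
      Submodule.mem_sup] at this
    obtain ⟨y, hy, w, hw, hyw⟩ := this
    obtain ⟨g, hg, rfl⟩ := mem_span_singleton_smul_iff.mp hy
    exact ⟨g, hg, by simpa [← hyw] using hw⟩
  have h𝔟top : 𝔟 ≠ ⊤ := fun htop ↦
    (maximalIdeal.isMaximal A).ne_top (top_le_iff.mp (htop ▸ h𝔟c.trans hcm))
  have : Nontrivial (A ⧸ 𝔟) := Ideal.Quotient.nontrivial_iff.mpr h𝔟top
  have hB : IsLocalRing (A ⧸ 𝔟) := .of_surjective' (Ideal.Quotient.mk 𝔟) Ideal.Quotient.mk_surjective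
  have hlocB := IsLocalHom.of_surjective (Ideal.Quotient.mk 𝔟) Ideal.Quotient.mk_surjective
  set b : A ⧸ 𝔟 := Ideal.Quotient.mk 𝔟 (a l) with hb
  have hbm : b ∈ maximalIdeal (A ⧸ 𝔟) := by
    rw [hb, mem_maximalIdeal, mem_nonunits_iff, isUnit_map_iff, ← mem_nonunits_iff,
      ← mem_maximalIdeal]
    exact ha.1.mem_maximalIdeal l
  refine ⟨inferInstance, hB, 1, hasInjectiveDimensionLE_one hbm (fun z hz ↦ ?_) ?_⟩
  · obtain ⟨z, rfl⟩ := Ideal.Quotient.mk_surjective z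
    rw [hb, ← map_mul, Ideal.Quotient.eq_zero_iff_mem, hmem, map_mul, ← Algebra.smul_def] at hz
    exact Ideal.Quotient.eq_zero_iff_mem.mpr (hreg (algebraMap_mem_sectionModule z) hz)
  have hC : Nontrivial ((A ⧸ 𝔟) ⧸ Ideal.span {b}) :=
    Ideal.Quotient.nontrivial_iff.mpr fun htop ↦ (maximalIdeal.isMaximal (A ⧸ 𝔟)).ne_top
      (top_le_iff.mp (htop ▸ (Ideal.span_singleton_le_iff_mem _).mpr hbm))
  have : IsLocalRing ((A ⧸ 𝔟) ⧸ Ideal.span {b}) :=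
    .of_surjective' (Ideal.Quotient.mk _) Ideal.Quotient.mk_surjective
  set f : A →+* (A ⧸ 𝔟) ⧸ Ideal.span {b} :=
    (Ideal.Quotient.mk (Ideal.span {b})).comp (Ideal.Quotient.mk 𝔟)
  have hf0 (z : A) : f z = 0 ↔ ∃ s, z - a l * s ∈ 𝔟 := by
    rw [RingHom.comp_apply, Ideal.Quotient.eq_zero_iff_mem, Ideal.mem_span_singleton']
    constructor
    · rintro ⟨s, hs⟩
      obtain ⟨s, rfl⟩ := Ideal.Quotient.mk_surjective s
      rw [hb, ← map_mul, eq_comm, Ideal.Quotient.eq] at hs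
      exact ⟨s, by rwa [mul_comm]⟩
    · rintro ⟨s, hs⟩
      exact ⟨Ideal.Quotient.mk 𝔟 s, by
        rw [hb, ← map_mul, eq_comm, Ideal.Quotient.eq, mul_comm s]; exact hs⟩
  obtain ⟨k, hk⟩ := ha.1.exists_pow_le
  have hqf : Ideal.span (Set.range a) ≤ RingHom.ker f := by
    rw [Ideal.span_le]
    rintro _ ⟨i, rfl⟩
    refine (hf0 _).mpr ?_
    rcases Finset.mem_insert.mp (hT ▸ Finset.mem_univ i) with rfl | hi
    · exact ⟨1, by simp⟩
    · refine ⟨0, ?_⟩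
      rw [mul_zero, sub_zero]
      exact map_linearMap_le_smul_sectionModule _ ⟨_, Ideal.subset_span ⟨i, hi, rfl⟩, rfl⟩
  have hsoc (z : A) (hz : ∀ r ∈ maximalIdeal A, f (r * z) = 0) : ∃ g ∈ sectionModule A,
      algebraMap A (FractionRing A) z - a l • g ∈ Ideal.span (a '' T) • sectionModule A ∧
      ∀ r ∈ maximalIdeal A, r • g ∈ (1 : Submodule A (FractionRing A)) := by
    -- For `g ∈ S` the element `u = a l * g` lies in `𝔠 ⊆ 𝔪`, so `z u ∈ (a l)A + 𝔟`; cancelling `a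
    -- l` leaves `z g ∈ A`.
    have hzc : z ∈ annH1 A := by
      refine (mem_annH1_iff h₀ hr).mpr fun g hg ↦ ?_
      obtain ⟨u, hu, hug⟩ := exists_mem_annH1_of_smul h₀ hr (ha.mem_annH1 h₀ hr hd l) hg
      obtain ⟨s, hs⟩ := (hf0 _).mp (hz u (hcm hu))
      refine hregb (Submodule.smul_mem _ _ hg) (s := s) ?_
      rwa [smul_comm, ← hug, Algebra.smul_def, ← map_mul, ← map_sub, mul_comm z]
    -- Now `𝔠 = 𝔮S` gives `z = a l * g` modulo `(a_T)S`, and the same cancellation shows `𝔪 g ⊆ A`.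
    obtain ⟨g, hg, hgz⟩ := hdec hzc
    refine ⟨g, hg, hgz, fun r hrm ↦ ?_⟩
    obtain ⟨s, hs⟩ := (hf0 _).mp (hz r hrm)
    refine hregb (Submodule.smul_mem _ _ hg) (s := s) ?_
    have := sub_mem ((hmem _).mp hs) (Submodule.smul_mem _ r hgz)
    convert this using 1
    rw [smul_sub, smul_comm r, map_sub, map_mul _ r, Algebra.smul_def r (algebraMap _ _ z)]
    ring
  have hmem_one {z : A} {g : FractionRing A} (hg : g ∈ (1 : Submodule A (FractionRing A)))
      (hgz : algebraMap A (FractionRing A) z - a l • g ∈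
        Ideal.span (a '' T) • sectionModule A) : f z = 0 := by
    obtain ⟨s, rfl⟩ := Submodule.mem_one.mp hg
    refine (hf0 _).mpr ⟨s, ?_⟩
    rw [hmem, map_sub, map_mul, ← Algebra.smul_def]
    exact hgz
  refine baer_self_of_surjective f (Ideal.Quotient.mk_surjective.comp Ideal.Quotient.mk_surjective)
    (k := k) (fun r hrk ↦ hqf (hk hrk)) fun z w hz hw hz0 ↦ ?_
  obtain ⟨g, hg, hgz, hgs⟩ := hsoc z hz
  obtain ⟨g', hg', hgw, hgs'⟩ := hsoc w hw
  -- If `g` were in `A`, then `z` would vanish in the quotient. So `g` generates the socle of `S/A`,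
  -- and the relation `g' ≡ r g` multiplied by `a l` gives `w ≡ r z`.
  obtain ⟨r, hrg⟩ := (exists_socle_sectionModule h₀ hr hdepth htype).2 g g'
    (fun hg1 ↦ hz0 (hmem_one hg1 hgz)) hgs hgs'
  refine ⟨r, sub_eq_zero.mp ?_⟩
  rw [← map_sub]
  refine hmem_one hrg ?_
  have := sub_mem hgw (Submodule.smul_mem _ r hgz)
  convert this using 1
  rw [smul_sub, smul_sub, smul_comm r, map_sub, map_mul, Algebra.smul_def r (algebraMap _ _ z)]
  ring

end Gorenstein

end

theorem mainTheorem5 {A : Type*} [CommRing A] [IsLocalRing A] [IsNoetherianRing A]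
    {d : ℕ} (hd : 2 ≤ d) (a : Fin d → A) (ha : IsStandardSystemOfParameters a)
    (hH : ∀ i : ℕ, i ≠ 1 → i ≠ d →
      Subsingleton ((localCohomology (IsLocalRing.maximalIdeal A) i).obj (ModuleCat.of A A)))
    (hdepth : depthLocal A A = 1) (htype : typeLocal A A = 1) :
    (sigmaTilde a = annH1 A ↔
      (∃ e : ℕ, HasMultiplicity (annH1 A) e ∧
        (e : ℕ∞) = 2 * Module.length A (A ⧸ annH1 A)) ∧
      IsReductionOf (Ideal.span (Set.range a)) (annH1 A)) ∧
    (sigmaTilde a = annH1 A →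
      ∀ x ∈ annH1 A, ∀ y ∈ annH1 A, IsFilterRegularPair x y →
        Submodule.map (Algebra.linearMap A (FractionRing A)) (annH1 A) =
          Ideal.span (Set.range a) • tildeRing x y ∧
        IsGorensteinLocalRing (A ⧸ (Submodule.comap (Algebra.linearMap A (FractionRing A))
          (Ideal.span (a '' {i | i.val + 1 < d}) • tildeRing x y) : Ideal A))) := by
  obtain ⟨r₀, h₀, hr⟩ := exists_nonZeroDivisor_of_depthLocal_eq_one hdepth
  refine ⟨ha.sigmaTilde_eq_annH1_iff_multiplicity h₀ hr hd hdepth htype hH,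
    fun h x hx y hy hxy ↦ ?_⟩
  rw [tildeRing_eq_sectionModule h₀ hr hx hy hxy]
  have hmap := ha.map_sigmaTilde h₀ hr hd hH
  rw [h] at hmap
  -- Indices start at `0`, so the generators kept are all but the one of index `d - 1`.
  have hT : {i : Fin d | i.val + 1 < d} =
      (Finset.univ.erase (⟨d - 1, by lia⟩ : Fin d) : Finset (Fin d)) := by
    ext i
    simp only [Set.mem_ofPred_eq, Finset.coe_erase, Finset.coe_univ, Set.mem_sdiff, Set.mem_univ,
      Set.mem_singleton_iff, true_and, Fin.ext_iff]
    lia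
  rw [hT]
  exact ⟨hmap, ha.isGorensteinLocalRing_quotient h₀ hr hd hdepth htype hH hmap
    (Finset.notMem_erase _ _) (Finset.insert_erase (Finset.mem_univ _))⟩
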